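/- Let $\mathtt k$ be an algebraically closed field of characteristic zero, let $n,m$ be positive integers, and let $\mathfrak g=\mathfrak{gl}(n|m)$ or $\mathfrak g=\mathfrak{sl}(n|m)$. Let $\epsilon_1,\dots,\epsilon_n,\delta_1,\dots,\delta_m$ be the coordinate functionals on the diagonal matrices. For each ordering $(\eta_1,\dots,\eta_{n+m})$ of $\{\epsilon_1,\dots,\epsilon_n,\delta_1,\dots,\delta_m\}$ there is a Borel subalgebra of $\mathfrak g$, spanned by the diagonal matrices in $\mathfrak g$ and the root spaces $\mathfrak g^{\eta_a-\eta_b}$ with $a<b$; its simple roots are $\eta_a-\eta_{a+1}$. The distinguished Borel subalgebra $\mathfrak b$ is the one for the ordering $(\epsilon_1,\dots,\epsilon_n,\delta_1,\dots,\delta_m)$. Two Borel subalgebras are adjacent if the simple roots of the second are obtained from the set $\Pi$ of simple roots of the first by an odd reflection in some odd root $\alpha\in\Pi$, i.e. by the map $\alpha\mapsto-\alpha$ and, for $\beta\in\Pi\setminus\{\alpha\}$, $\beta\mapsto\alpha+\beta$ if $\alpha+\beta$ is a root and $\beta\mapsto\beta$ otherwise. Let $\rho_0$ and $\rho_1$ be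 the half-sums of the positive even and of the positive odd roots of $\mathfrak b$, let $\rho=\rho_0-\rho_1$ and $\lambda=-\rho$, and let $M(\lambda)=U(\mathfrak g)\otimes_{U(\mathfrak b)}\mathtt k_\lambda$ be the Verma module with highest weight vector $v_\lambda$. Then $M(-\rho)$ is reflection complete, that is: let $\mathfrak b=\mathfrak b^{(0)},\mathfrak b^{(1)},\dots,\mathfrak b^{(r)}$ be any sequence of Borel subalgebras of $\mathfrak g$ such that $\mathfrak b^{(i-1)}$ and $\mathfrak b^{(i)}$ are adjacent for $1\le i\le r$, and let $\beta_1,\dots,\beta_r$ be positive odd roots of $\mathfrak b$ with $\mathfrak g^{\beta_i}\subset\mathfrak b^{(i-1)}$ and $\mathfrak g^{-\beta_i}\subset\mathfrak b^{(i)}$. Let $x_i$ be a nonzero element of $\mathfrak g^{-\beta_i}$, and set $v_0=v_\lambda$ and $v_i=x_iv_{i-1}$ for $1\le i\le r$. Then for $0\le i\le r$ the vector $v_i$ is a (nonzero) highest weight vector for $\mathfrak b^{(i)}$ of weight $\lambda-\beta_1-\dots-\beta_i$, and for $1\le i\le r$ the submodule $U(\mathfrak g)v_i$ is properly contained in $U(\mathfrak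 g)v_{i-1}$. -/

import Mathlib

open scoped BigOperators

noncomputable section

namespace SuperGL

variable {k : Type*} [Field k] {n m : ℕ}

/-- The index set of the rows and columns of `gl(n|m)`: `Sum.inl i` stands for the even index `i`,
`Sum.inr j` for the odd index `j'`. -/
abbrev Idx (n m : ℕ) : Type := Fin n ⊕ Fin m

/-- The parity of an index. -/
def par : Idx n m → ZMod 2 := Sum.elim (fun _ => 0) (fun _ => 1)

/-- The space of `(n+m) × (n+m)` matrices, the underlying space of `gl(n|m)`. -/
abbrev Mat (k : Type*) (n m : ℕ) : Type _ := Matrix (Idx n m) (Idx n m) k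

/-- The component of degree `p` of a matrix: for `p = 0` the two diagonal blocks, for `p = 1` the
two off-diagonal blocks. -/
def comp (p : ZMod 2) (x : Mat k n m) : Mat k n m :=
  fun i j => if par i + par j = p then x i j else 0

/-- A matrix is homogeneous of degree `p`. -/
def IsHomog (p : ZMod 2) (x : Mat k n m) : Prop := comp p x = x

/-- The sign `(-1)^{pq}`. -/
def sgn (k : Type*) [Field k] (p q : ZMod 2) : k := if p = 1 ∧ q = 1 then -1 else 1

/-- The supercommutator: the bilinear operation which on homogeneous `x`, `y` of degrees `p`, `q` is
`x y - (-1)^{pq} y x`. -/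
def superBracket (x y : Mat k n m) : Mat k n m :=
  ∑ p : ZMod 2, ∑ q : ZMod 2,
    (comp p x * comp q y - sgn k p q • (comp q y * comp p x))

/-- The supertrace. -/
def str (x : Mat k n m) : k := ∑ i, (if par i = 1 then (-1 : k) else 1) * x i i

/-- A Lie subsuperalgebra of `gl(n|m)`: a graded subspace closed under the supercommutator. -/
structure LieSubsuperalgebra (k : Type*) [Field k] (n m : ℕ) extends Submodule k (Mat k n m) where
  comp_mem : ∀ (p : ZMod 2) (x : Mat k n m), x ∈ toSubmodule → comp p x ∈ toSubmodule
  bracket_mem : ∀ x y : Mat k n m, x ∈ toSubmodule → y ∈ toSubmodule →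
    superBracket x y ∈ toSubmodule

/-- `gl(n|m)`. -/
def gl (k : Type*) [Field k] (n m : ℕ) : LieSubsuperalgebra k n m where
  toSubmodule := ⊤
  comp_mem := fun _ _ _ => Submodule.mem_top
  bracket_mem := fun _ _ _ _ => Submodule.mem_top

theorem comp_diag (p : ZMod 2) (x : Mat k n m) (i : Idx n m) :
    comp p x i i = if p = 0 then x i i else 0 := by
  have h : par i + par i = 0 := CharTwo.add_self_eq_zero _
  simp only [comp, h, eq_comm]

theorem str_comm (p q : ZMod 2) (x y : Mat k n m) :
    str (comp p x * comp q y) = sgn k p q * str (comp q y * comp p x) := by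
  simp only [str, Matrix.mul_apply, Finset.mul_sum]
  rw [Finset.sum_comm]
  refine Finset.sum_congr rfl fun i _ => Finset.sum_congr rfl fun j _ => ?_
  simp only [comp, sgn]
  have two : ∀ a : ZMod 2, a = 0 ∨ a = 1 := by decide
  have h11 : (1 : ZMod 2) + 1 = 0 := rfl
  rcases two (par i) with ha | ha <;> rcases two (par j) with hb | hb <;>
    rcases two p with rfl | rfl <;> rcases two q with rfl | rfl <;>
    simp [ha, hb, h11, mul_comm]

theorem str_sub (x y : Mat k n m) : str (x - y) = str x - str y := by
  simp [str, mul_sub, Finset.sum_sub_distrib]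

theorem str_smul (c : k) (x : Mat k n m) : str (c • x) = c * str x := by
  simp only [str, Finset.mul_sum, Matrix.smul_apply, smul_eq_mul]
  exact Finset.sum_congr rfl fun _ _ => by ring

theorem str_add (x y : Mat k n m) : str (x + y) = str x + str y := by
  simp only [str, Matrix.add_apply, mul_add, Finset.sum_add_distrib]

theorem str_comp (p : ZMod 2) (x : Mat k n m) :
    str (comp p x) = if p = 0 then str x else 0 := by
  simp only [str, comp_diag]
  by_cases h : p = 0
  · simp only [h, if_true]
  · simp only [h, if_false, mul_zero, Finset.sum_const_zero]

theorem str_sum {ι : Type*} (s : Finset ι) (f : ι → Mat k n m) :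
    str (∑ a ∈ s, f a) = ∑ a ∈ s, str (f a) := by
  simp only [str, Matrix.sum_apply, Finset.mul_sum]
  exact Finset.sum_comm

/-- `sl(n|m)`: the matrices of supertrace zero. -/
def sl (k : Type*) [Field k] (n m : ℕ) : LieSubsuperalgebra k n m where
  carrier := {x | str x = 0}
  add_mem' := by
    intro x y hx hy
    change str (x + y) = 0
    rw [str_add, show str x = 0 from hx, show str y = 0 from hy, add_zero]
  zero_mem' := by simp [str]
  smul_mem' := by
    intro c x hx
    change str (c • x) = 0
    rw [str_smul, show str x = 0 from hx, mul_zero]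
  comp_mem := by
    intro p x hx
    change str (comp p x) = 0
    rw [str_comp, show str x = 0 from hx, ite_self]
  bracket_mem := by
    intro x y _ _
    change str (superBracket x y) = 0
    simp only [superBracket, str_sum, str_sub, str_smul]
    refine Finset.sum_eq_zero fun p _ => Finset.sum_eq_zero fun q _ => ?_
    rw [str_comm, sub_self]

/-! ### Roots and Borel subalgebras -/

/-- The weight `ε_i` in integral coordinates; for `i = Sum.inr j` this is `δ_j`. -/
def eps (i : Idx n m) : Idx n m → ℤ := Pi.single i 1

/-- The roots `ε_i - ε_j`, `i ≠ j`, common to `gl(n|m)` and `sl(n|m)`. -/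
def IsRoot (α : Idx n m → ℤ) : Prop := ∃ i j, i ≠ j ∧ α = eps i - eps j

/-- The odd roots `±(ε_i - δ_j)`; all of them are isotropic. -/
def IsOddRoot (α : Idx n m → ℤ) : Prop := ∃ i j, par i ≠ par j ∧ α = eps i - eps j

/-- The simple roots `ε_{w(a)} - ε_{w(a+1)}` attached to the one line notation `w` of a
permutation of the indices. -/
def simpleRoots (w : Fin (n + m) ≃ Idx n m) : Set (Idx n m → ℤ) :=
  {α | ∃ a b : Fin (n + m), (a : ℕ) + 1 = (b : ℕ) ∧ α = eps (w a) - eps (w b)}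

/-- The positive roots `ε_{w(a)} - ε_{w(b)}`, `a < b`. -/
def positiveRoots (w : Fin (n + m) ≃ Idx n m) : Set (Idx n m → ℤ) :=
  {α | ∃ a b : Fin (n + m), a < b ∧ α = eps (w a) - eps (w b)}

theorem comp_tri {w : Fin (n + m) ≃ Idx n m} {x : Mat k n m} (p : ZMod 2)
    (hx : ∀ i j, w.symm j < w.symm i → x i j = 0) :
    ∀ i j, w.symm j < w.symm i → comp p x i j = 0 := by
  intro i j h
  simp [comp, hx i j h]

theorem mul_tri {w : Fin (n + m) ≃ Idx n m} {x y : Mat k n m}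
    (hx : ∀ i j, w.symm j < w.symm i → x i j = 0)
    (hy : ∀ i j, w.symm j < w.symm i → y i j = 0) :
    ∀ i j, w.symm j < w.symm i → (x * y) i j = 0 := by
  intro i j h
  rw [Matrix.mul_apply]
  refine Finset.sum_eq_zero fun l _ => ?_
  rcases lt_or_ge (w.symm l) (w.symm i) with h1 | h1
  · rw [hx i l h1, zero_mul]
  · rw [hy l j (lt_of_lt_of_le h h1), mul_zero]

/-- The Borel subalgebra of `g` attached to `w`, spanned by the diagonal matrices in `g` and by the
root spaces for the positive roots of `w`. -/
def borel (g : LieSubsuperalgebra k n m) (w : Fin (n + m) ≃ Idx n m) :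
    LieSubsuperalgebra k n m where
  carrier := {x | x ∈ g.toSubmodule ∧ ∀ i j, w.symm j < w.symm i → x i j = 0}
  add_mem' := by
    rintro x y ⟨hx, hx'⟩ ⟨hy, hy'⟩
    exact ⟨g.toSubmodule.add_mem hx hy, fun i j h => by simp [hx' i j h, hy' i j h]⟩
  zero_mem' := ⟨g.toSubmodule.zero_mem, fun _ _ _ => rfl⟩
  smul_mem' := by
    rintro c x ⟨hx, hx'⟩
    exact ⟨g.toSubmodule.smul_mem c hx, fun i j h => by simp [hx' i j h]⟩
  comp_mem := by
    rintro p x ⟨hx, hx'⟩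
    exact ⟨g.comp_mem p x hx, comp_tri p hx'⟩
  bracket_mem := by
    rintro x y ⟨hx, hx'⟩ ⟨hy, hy'⟩
    refine ⟨g.bracket_mem x y hx hy, fun i j h => ?_⟩
    simp only [superBracket, Matrix.sum_apply, Matrix.sub_apply, Matrix.smul_apply]
    refine Finset.sum_eq_zero fun p _ => Finset.sum_eq_zero fun q _ => ?_
    rw [mul_tri (comp_tri p hx') (comp_tri q hy') i j h,
      mul_tri (comp_tri q hy') (comp_tri p hx') i j h, smul_zero, sub_zero]

/-- The one line notation `(1, …, n, 1', …, m')` of the distinguished Borel subalgebra. -/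
def dist (n m : ℕ) : Fin (n + m) ≃ Idx n m := finSumFinEquiv.symm

open Classical in
/-- The effect on simple roots of the odd reflection in the simple root `α`. -/
def reflect (α β : Idx n m → ℤ) : Idx n m → ℤ :=
  if β = α then -α else if IsRoot (α + β) then α + β else β

/-- Two Borel subalgebras of `g` are adjacent if the simple roots of the second are obtained from
those of the first by an odd reflection. -/
def Adjacent (g b b' : LieSubsuperalgebra k n m) : Prop :=
  ∃ (w w' : Fin (n + m) ≃ Idx n m) (α : Idx n m → ℤ),
    b = borel g w ∧ b' = borel g w' ∧ α ∈ simpleRoots w ∧ IsOddRoot α ∧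
      simpleRoots w' = reflect α '' simpleRoots w

/-- The root space `g^α`: the elements of `g` on which the diagonal matrices act, by the adjoint
action, through `α`. -/
def rootSpace (g : LieSubsuperalgebra k n m) (α : Idx n m → ℤ) : Set (Mat k n m) :=
  {x | x ∈ g.toSubmodule ∧
    ∀ d : Idx n m → k, superBracket (Matrix.diagonal d) x = (∑ i, (α i : k) * d i) • x}

/-- Half the sum of the positive even roots, in the coordinates `ε_1, …, ε_n, δ_1, …, δ_m`. -/
def rho0 (k : Type*) [Field k] (w : Fin (n + m) ≃ Idx n m) : Idx n m → k := fun i =>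
  (1 / 2) * ∑ p : Idx n m × Idx n m with w.symm p.1 < w.symm p.2 ∧ par p.1 = par p.2,
    (((eps p.1 - eps p.2) i : ℤ) : k)

/-- Half the sum of the positive odd roots. -/
def rho1 (k : Type*) [Field k] (w : Fin (n + m) ≃ Idx n m) : Idx n m → k := fun i =>
  (1 / 2) * ∑ p : Idx n m × Idx n m with w.symm p.1 < w.symm p.2 ∧ par p.1 ≠ par p.2,
    (((eps p.1 - eps p.2) i : ℤ) : k)

/-- The vector `ρ = ρ₀ - ρ₁`. -/
def rho (k : Type*) [Field k] (w : Fin (n + m) ≃ Idx n m) : Idx n m → k := rho0 k w - rho1 k w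

/-! ### The enveloping algebra and Verma modules -/

/-- The defining relations `x y = (-1)^{pq} y x + [x, y]` of the enveloping algebra, for `x`, `y`
homogeneous of degrees `p`, `q`. -/
inductive EnvRel (g : LieSubsuperalgebra k n m) :
    TensorAlgebra k g.toSubmodule → TensorAlgebra k g.toSubmodule → Prop
  | mk (p q : ZMod 2) (x y : g.toSubmodule) (hx : IsHomog p x.1) (hy : IsHomog q y.1) :
      EnvRel g
        (TensorAlgebra.ι k x * TensorAlgebra.ι k y)
        (sgn k p q • (TensorAlgebra.ι k y * TensorAlgebra.ι k x) +
          TensorAlgebra.ι k ⟨superBracket x.1 y.1, g.bracket_mem x.1 y.1 x.2 y.2⟩)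

/-- The universal enveloping algebra `U(g)`. -/
abbrev Env (g : LieSubsuperalgebra k n m) : Type _ := RingQuot (EnvRel g)

/-- The canonical map `g → U(g)`. -/
def toEnv (g : LieSubsuperalgebra k n m) (x : g.toSubmodule) : Env g :=
  RingQuot.mkAlgHom k (EnvRel g) (TensorAlgebra.ι k x)

/-- The value of the weight `lam` on (the diagonal part of) a matrix. On a Borel subalgebra this is
the one-dimensional representation of weight `lam`. -/
def evalWt (lam : Idx n m → k) (x : Mat k n m) : k := ∑ i, lam i * x i i

/-- The left ideal of `U(g)` generated by the elements `x - lam(x)`, for `x` in the Borel subalgebra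
attached to `w`. -/
def vermaIdeal (g : LieSubsuperalgebra k n m) (w : Fin (n + m) ≃ Idx n m) (lam : Idx n m → k) :
    Submodule (Env g) (Env g) :=
  Submodule.span (Env g)
    {u | ∃ x : g.toSubmodule, x.1 ∈ (borel g w).toSubmodule ∧
      u = toEnv g x - algebraMap k (Env g) (evalWt lam x.1)}

/-- The Verma module `U(g) ⊗_{U(b)} k_lam` induced from the one-dimensional representation of weight
`lam` of the Borel subalgebra `b` attached to `w`, realized as a quotient of `U(g)`. -/
abbrev Verma (g : LieSubsuperalgebra k n m) (w : Fin (n + m) ≃ Idx n m) (lam : Idx n m → k) :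
    Type _ := Env g ⧸ vermaIdeal g w lam

/-- The highest weight vector `v_lam = 1 ⊗ 1` of the Verma module. -/
def hwv (g : LieSubsuperalgebra k n m) (w : Fin (n + m) ≃ Idx n m) (lam : Idx n m → k) :
    Verma g w lam := Submodule.Quotient.mk 1

/-- `v` is a (nonzero) highest weight vector of weight `mu` for the Borel subalgebra `b` of `g`. -/
def IsHighestWeightVector (g b : LieSubsuperalgebra k n m) {M : Type*} [AddCommGroup M]
    [Module (Env g) M] (mu : Idx n m → k) (v : M) : Prop :=
  v ≠ 0 ∧ ∀ x : g.toSubmodule, x.1 ∈ b.toSubmodule →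
    toEnv g x • v = algebraMap k (Env g) (evalWt mu x.1) • v

/-! ### Chains of odd reflections -/

/-- A chain `b 0, …, b r` of adjacent Borel subalgebras of `g` starting at the distinguished one,
with the odd roots `β i`, positive for the distinguished Borel subalgebra, in which consecutive
members differ, root vectors `x i` of weight `-β i`, and the vectors `v 0, …, v r` obtained from
the highest weight vector of the Verma module by applying the `x i` successively. -/
structure IsReflectionChain (g : LieSubsuperalgebra k n m) (lam : Idx n m → k) {r : ℕ}
    (b : Fin (r + 1) → LieSubsuperalgebra k n m) (β : Fin r → Idx n m → ℤ)
    (x : Fin r → g.toSubmodule) (v : Fin (r + 1) → Verma g (dist n m) lam) : Prop where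
  b_zero : b 0 = borel g (dist n m)
  adjacent : ∀ i : Fin r, Adjacent g (b i.castSucc) (b i.succ)
  odd : ∀ i, IsOddRoot (β i)
  positive : ∀ i, β i ∈ positiveRoots (dist n m)
  root_subset : ∀ i : Fin r, rootSpace g (β i) ⊆ (b i.castSucc).toSubmodule
  neg_root_subset : ∀ i : Fin r, rootSpace g (-β i) ⊆ (b i.succ).toSubmodule
  x_mem : ∀ i, (x i : Mat k n m) ∈ rootSpace g (-β i)
  x_ne : ∀ i, x i ≠ 0
  v_zero : v 0 = hwv g (dist n m) lam
  v_succ : ∀ i : Fin r, v i.succ = toEnv g (x i) • v i.castSucc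

/-- The weight `lam - (β 0 + … + β (i-1))` of the vector `v i` of a chain. -/
def chainWeight (lam : Idx n m → k) {r : ℕ} (β : Fin r → Idx n m → ℤ) (i : Fin (r + 1)) :
    Idx n m → k :=
  fun l => lam l - ∑ j : Fin r with j.castSucc < i, (β j l : k)

/-- The Verma module of highest weight `lam` for the distinguished Borel subalgebra is reflection
complete: along every chain of adjacent Borel subalgebras, the vectors `v i` are highest weight
vectors (in particular nonzero) for `b i`, and `U(g) v (i+1)` is properly contained in
`U(g) v i`. -/
def ReflectionComplete (g : LieSubsuperalgebra k n m) (lam : Idx n m → k) : Prop :=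
  ∀ (r : ℕ) (b : Fin (r + 1) → LieSubsuperalgebra k n m) (β : Fin r → Idx n m → ℤ)
    (x : Fin r → g.toSubmodule) (v : Fin (r + 1) → Verma g (dist n m) lam),
    IsReflectionChain g lam b β x v →
      (∀ i : Fin (r + 1), IsHighestWeightVector g (b i) (chainWeight lam β i) (v i)) ∧
      ∀ i : Fin r,
        Submodule.span (Env g) {v i.succ} < Submodule.span (Env g) {v i.castSucc}

end SuperGL

end

open scoped BigOperators

noncomputable section

namespace SuperGL

variable {k : Type*} [Field k] {n m : ℕ}

open scoped TensorProduct

/-! ### Signs and supercommutators -/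

/-! The highest weight relations along a chain are formal. Let $u$ be a highest weight vector of
weight $\mu$ for an ordering, with an odd simple root $\alpha$ at the adjacent positions $s,t$. Then
$E_{ts}u$ satisfies the relations of the reflected Borel with weight $\mu-\alpha$, because
$E_{ts}^2=0$ and brackets of $E_{ts}$ with the other raising units stay raising. Since $\rho$
becomes $\rho+\alpha$ under the reflection, each $v_i$ has weight minus the $\rho$ of its own Borel
(`rho_swapAt`). Nonvanishing and properness remain.

Nonvanishing is detected in an explicit module. $\mathfrak{gl}(n|m)$ acts by the vector fields
$\sum_l X_{il}\,\partial/\partial X_{jl}$ on functions of a generic supermatrix: power series in the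
even coordinates around the identity matrix, tensored with the exterior algebra on the odd ones,
twisted by a multiple of the supertrace. Inverses of principal minors of the two even blocks, times
all odd variables $X_{ac}$ with $a$ even and $c$ odd, give a vector $u_0$ of weight $-\rho$ for the
distinguished Borel (`exists_fock_vector`), so $M(-\rho)$ maps to this module. Evaluating at the
identity and killing the odd variables in odd rows turns $E_{ca}$ into $\partial/\partial X_{ac}$
(`fockEval_fockUnits`). A chain moves each $c$ past an $a$ at most once, so it only strips distinct
factors from a nonzero product.

Properness comes from $\rho$ being orthogonal to an isotropic simple root (`rho_add_rho_eq_zero`):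
$E_{st}E_{ts}u=0$, so $E_{ts}u$ is singular for the old Borel as well (`IsSingular.of_reflect`). The
submodule it generates has no weights above $\mu-\alpha$, hence cannot contain $u$
(`exists_stable_submodule`). -/

theorem zmod_two_cases (a : ZMod 2) : a = 0 ∨ a = 1 := by
  revert a; decide

@[simp] theorem sgn_zero_left (p : ZMod 2) : sgn k 0 p = 1 := by simp [sgn]

@[simp] theorem sgn_zero_right (p : ZMod 2) : sgn k p 0 = 1 := by simp [sgn]

@[simp] theorem sgn_one_one : sgn k 1 1 = -1 := by simp [sgn]

theorem IsHomog.apply_eq_zero {p : ZMod 2} {x : Mat k n m} (hx : IsHomog p x) {i j : Idx n m}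
    (h : par i + par j ≠ p) : x i j = 0 := by
  have := congrFun (congrFun hx i) j
  rw [← this]
  simp [comp, h]

theorem IsHomog.comp_eq {p : ZMod 2} {x : Mat k n m} (hx : IsHomog p x) (q : ZMod 2) :
    comp q x = if q = p then x else 0 := by
  split_ifs with h
  · rw [h]; exact hx
  · ext i j
    simp only [comp, Matrix.zero_apply, ite_eq_right_iff]
    intro hq
    exact hx.apply_eq_zero (hq ▸ h)

theorem superBracket_of_isHomog {p q : ZMod 2} {x y : Mat k n m} (hx : IsHomog p x)
    (hy : IsHomog q y) : superBracket x y = x * y - sgn k p q • (y * x) := by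
  unfold superBracket
  rw [Finset.sum_eq_single p, Finset.sum_eq_single q]
  · rw [hx.comp_eq, hy.comp_eq, if_pos rfl, if_pos rfl]
  · intro b _ hb
    rw [hy.comp_eq, if_neg hb]; simp
  · simp
  · intro b _ hb
    refine Finset.sum_eq_zero fun c _ => ?_
    rw [hx.comp_eq, if_neg hb]; simp
  · simp

theorem isHomog_single (i j : Idx n m) (c : k) :
    IsHomog (par i + par j) (Matrix.single i j c : Mat k n m) := by
  ext r s
  simp only [comp, ite_eq_left_iff]
  intro h
  rw [Matrix.single_apply_of_ne]
  rintro ⟨rfl, rfl⟩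
  exact h rfl

theorem isHomog_diagonal (d : Idx n m → k) : IsHomog 0 (Matrix.diagonal d : Mat k n m) := by
  ext r s
  simp only [comp, ite_eq_left_iff]
  intro h
  rw [Matrix.diagonal_apply_ne]
  rintro rfl
  exact h (CharTwo.add_self_eq_zero _)

/-! ### Matrix unit relations and representations -/

variable {A : Type*} [Ring A] [Algebra k A]

/-- The elements `E i j` satisfy the supercommutation relations of the matrix units of
`gl(n|m)`. -/
def IsMatrixUnits (E : Idx n m → Idx n m → A) : Prop :=
  ∀ i j p q, E i j * E p q =
    sgn k (par i + par j) (par p + par q) • (E p q * E i j) +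
      ((if j = p then E i q else 0) -
        sgn k (par i + par j) (par p + par q) • (if q = i then E p j else 0))

/-- The linear map from matrices sending the matrix units to the elements `E i j`. -/
def ofUnits (E : Idx n m → Idx n m → A) : Mat k n m →ₗ[k] A where
  toFun x := ∑ i, ∑ j, x i j • E i j
  map_add' x y := by simp [add_smul, Finset.sum_add_distrib]
  map_smul' c x := by simp [mul_smul, Finset.smul_sum]

theorem ofUnits_apply (E : Idx n m → Idx n m → A) (x : Mat k n m) :
    ofUnits (k := k) E x = ∑ i, ∑ j, x i j • E i j := rfl

theorem ofUnits_single (E : Idx n m → Idx n m → A) (i j : Idx n m) (c : k) :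
    ofUnits E (Matrix.single i j c) = c • E i j := by
  rw [ofUnits_apply, Finset.sum_eq_single i, Finset.sum_eq_single j]
  · simp
  · intro b _ hb
    rw [Matrix.single_apply_of_ne]
    · simp
    · exact fun h => hb h.2.symm
  · simp
  · intro b _ hb
    refine Finset.sum_eq_zero fun c _ => ?_
    rw [Matrix.single_apply_of_ne]
    · simp
    · exact fun h => hb h.1.symm
  · simp

theorem IsHomog.induction_on {p : ZMod 2} {P : Mat k n m → Prop} (zero : P 0)
    (add : ∀ x y, P x → P y → P (x + y))
    (single : ∀ i j c, par i + par j = p → P (Matrix.single i j c)) {x : Mat k n m}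
    (hx : IsHomog p x) : P x := by
  rw [Matrix.matrix_eq_sum_single x]
  refine Finset.sum_induction _ P add zero fun i _ =>
    Finset.sum_induction _ P add zero fun j _ => ?_
  by_cases h : par i + par j = p
  · exact single i j _ h
  · rw [hx.apply_eq_zero h, Matrix.single_zero]
    exact zero

/-- Both sides are bilinear, and homogeneous matrices are sums of matrix units of the same degree.
This is exactly the defining relation of the enveloping algebra. -/
theorem ofUnits_mul_ofUnits {E : Idx n m → Idx n m → A} (hE : IsMatrixUnits (k := k) E)
    {p q : ZMod 2} {x y : Mat k n m} (hx : IsHomog p x) (hy : IsHomog q y) :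
    ofUnits (k := k) E x * ofUnits (k := k) E y =
      sgn k p q • (ofUnits (k := k) E y * ofUnits (k := k) E x) +
        ofUnits (k := k) E (superBracket x y) := by
  rw [superBracket_of_isHomog hx hy]
  refine hx.induction_on (P := fun x => ofUnits (k := k) E x * ofUnits (k := k) E y =
      sgn k p q • (ofUnits (k := k) E y * ofUnits (k := k) E x) +
        ofUnits (k := k) E (x * y - sgn k p q • (y * x))) (by simp) (fun x x' h h' => ?_)
      fun i j c hij => ?_
  · rw [map_add, add_mul, mul_add, h, h', add_mul, mul_add, map_sub, map_sub, map_sub, map_smul,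
      map_smul, map_smul, map_add, map_add, smul_add, smul_add]
    abel
  · refine hy.induction_on (P := fun y => ofUnits (k := k) E (Matrix.single i j c) *
      ofUnits (k := k) E y = sgn k p q • (ofUnits (k := k) E y *
        ofUnits (k := k) E (Matrix.single i j c)) +
        ofUnits (k := k) E (Matrix.single i j c * y - sgn k p q • (y * Matrix.single i j c)))
      (by simp) (fun y y' h h' => ?_) fun a b d hab => ?_
    · rw [map_add, add_mul, mul_add, h, h', add_mul, mul_add, map_sub, map_sub, map_sub, map_smul,
        map_smul, map_smul, map_add, map_add, smul_add, smul_add]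
      abel
    · rw [ofUnits_single, ofUnits_single, smul_mul_smul_comm, hE, hij, hab, smul_mul_smul_comm,
        map_sub, map_smul]
      have h1 : ofUnits E (Matrix.single i j c * Matrix.single a b d) =
          (c * d) • (if j = a then E i b else 0) := by
        split_ifs with h
        · subst h
          rw [Matrix.single_mul_single_same, ofUnits_single]
        · rw [Matrix.single_mul_single_of_ne _ _ _ _ h, map_zero, smul_zero]
      have h2 : ofUnits E (Matrix.single a b d * Matrix.single i j c) =
          (d * c) • (if b = i then E a j else 0) := by
        split_ifs with h
        · subst h
          rw [Matrix.single_mul_single_same, ofUnits_single]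
        · rw [Matrix.single_mul_single_of_ne _ _ _ _ h, map_zero, smul_zero]
      rw [h1, h2, mul_comm d c, smul_add, smul_sub, smul_comm (c * d), smul_comm (c * d)]

/-- The homomorphism from the enveloping algebra of a subsuperalgebra of `gl(n|m)` determined by
elements satisfying the relations of the matrix units. -/
def envLift (g : LieSubsuperalgebra k n m) {E : Idx n m → Idx n m → A}
    (hE : IsMatrixUnits (k := k) E) : Env g →ₐ[k] A :=
  RingQuot.liftAlgHom k ⟨TensorAlgebra.lift k (ofUnits E ∘ₗ g.toSubmodule.subtype), by
    rintro _ _ ⟨p, q, x, y, hx, hy⟩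
    simpa using ofUnits_mul_ofUnits hE hx hy⟩

theorem envLift_toEnv (g : LieSubsuperalgebra k n m) {E : Idx n m → Idx n m → A}
    (hE : IsMatrixUnits (k := k) E) (x : g.toSubmodule) :
    envLift g hE (toEnv g x) = ofUnits E x.1 := by
  simp [envLift, toEnv]

/-- The relations of the matrix units are preserved by adding a multiple of the supertrace. -/
theorem IsMatrixUnits.add_str {E : Idx n m → Idx n m → A} (hE : IsMatrixUnits (k := k) E) (t : k) :
    IsMatrixUnits (k := k) fun i j =>
      E i j + if i = j then algebraMap k A (sgn k (par i) (par i) * t) else 0 := by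
  intro i j p q
  simp only [add_mul, mul_add, hE i j p q]
  have h2 : ∀ a : ZMod 2, a + a = 0 := CharTwo.add_self_eq_zero
  by_cases hij : i = j
  · subst hij
    by_cases hpq : p = q
    · subst hpq
      simp only [h2, sgn_zero_left, one_smul, if_true, Algebra.algebraMap_eq_smul_one,
        smul_mul_assoc, mul_smul_comm, one_mul, mul_one, smul_smul]
      by_cases hip : i = p
      · subst hip; simp
      · simp [hip, Ne.symm hip, mul_comm (sgn k (par p) (par p) * t)]; abel
    · simp only [h2, sgn_zero_left, one_smul, if_true, if_neg hpq, Algebra.algebraMap_eq_smul_one,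
        smul_mul_assoc, mul_smul_comm, one_mul, mul_one, mul_zero,
        zero_mul, add_zero]
      by_cases hip : i = p
      · subst hip
        simp [hpq, Ne.symm hpq]; abel
      · by_cases hiq : q = i
        · subst hiq; simp [hip, Ne.symm hip]; abel
        · simp [hip, hiq]
  · by_cases hpq : p = q
    · subst hpq
      simp only [h2, sgn_zero_right, one_smul, if_true, if_neg hij, Algebra.algebraMap_eq_smul_one,
        smul_mul_assoc, mul_smul_comm, one_mul, mul_one, mul_zero,
        zero_mul, add_zero]
      by_cases hip : i = p
      · subst hip
        simp [hij, Ne.symm hij]; abel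
      · by_cases hiq : j = p
        · subst hiq; simp [hip, Ne.symm hip]; abel
        · simp [Ne.symm hip, hiq]
    · simp only [if_neg hij, if_neg hpq, mul_zero, zero_mul, add_zero]
      by_cases hjp : j = p
      · subst hjp
        by_cases hqi : q = i
        · subst hqi
          -- The bracket of $E_{ij}$ and $E_{ji}$ has diagonal terms at $i$ and $j$; their
          -- corrections cancel because the supertrace vanishes on brackets.
          simp only [if_true, smul_add, Algebra.algebraMap_eq_smul_one, smul_smul]
          rcases zmod_two_cases (par q) with ha | ha <;>
            rcases zmod_two_cases (par j) with hb | hb <;>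
            simp [ha, hb, h2]
        · simp [hqi, Ne.symm hqi]
      · by_cases hqi : q = i
        · subst hqi; simp [hjp, Ne.symm hjp]
        · simp [hjp, hqi]

/-! ### Oscillators -/

/-- Supercommuting variables `X i l` and derivatives `D i l`, of degree `par i + par l`. -/
structure IsOscillator (X D : Idx n m → Idx n m → A) : Prop where
  X_comm : ∀ i l j r, X i l * X j r = sgn k (par i + par l) (par j + par r) • (X j r * X i l)
  D_comm : ∀ i l j r, D i l * D j r = sgn k (par i + par l) (par j + par r) • (D j r * D i l)
  D_X : ∀ i l j r, D i l * X j r = sgn k (par i + par l) (par j + par r) • (X j r * D i l) +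
    if i = j ∧ l = r then 1 else 0

/-- Moving one quadratic expression past the other leaves only the two single contractions of a
derivative with a variable. -/
theorem IsOscillator.isMatrixUnits {X D : Idx n m → Idx n m → A}
    (h : IsOscillator (k := k) X D) :
    IsMatrixUnits (k := k) fun i j => ∑ l, X i l * D j l := by
  intro i j p q
  have term : ∀ l r, X i l * D j l * (X p r * D q r) =
      sgn k (par i + par j) (par p + par q) • (X p r * D q r * (X i l * D j l)) +
      ((if j = p ∧ l = r then X i l * D q r else 0) -
        sgn k (par i + par j) (par p + par q) • (if q = i ∧ r = l then X p r * D j l else 0)) := by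
    intro l r
    have e1 : X i l * D j l * (X p r * D q r) = X i l * (D j l * X p r) * D q r := by
      simp only [mul_assoc]
    have e2 : X p r * D q r * (X i l * D j l) = X p r * (D q r * X i l) * D j l := by
      simp only [mul_assoc]
    have e3 : X i l * X p r * (D j l * D q r) =
        (sgn k (par i + par l) (par p + par r) * sgn k (par j + par l) (par q + par r)) •
          (X p r * X i l * (D q r * D j l)) := by
      rw [h.X_comm, h.D_comm, smul_mul_smul_comm]
    -- The parities of the summed columns $l$, $r$ drop out, since $X_{il}D_{jl}$ has degree `par i
    -- + par j` for every $l$.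
    have hs : sgn k (par j + par l) (par p + par r) *
        (sgn k (par i + par l) (par p + par r) * sgn k (par j + par l) (par q + par r)) =
        sgn k (par i + par j) (par p + par q) * sgn k (par q + par r) (par i + par l) := by
      have h2 : (1 : ZMod 2) + 1 = 0 := rfl
      rcases zmod_two_cases (par i) with a | a <;> rcases zmod_two_cases (par j) with b | b <;>
      rcases zmod_two_cases (par p) with c | c <;> rcases zmod_two_cases (par q) with d | d <;>
      rcases zmod_two_cases (par l) with e | e <;> rcases zmod_two_cases (par r) with f | f <;>
      simp [a, b, c, d, e, f, h2]
    rw [e1, e2, h.D_X, h.D_X]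
    simp only [mul_add, add_mul, smul_add, mul_smul_comm, smul_mul_assoc, smul_smul]
    have e4 : X i l * (X p r * D j l) * D q r = X i l * X p r * (D j l * D q r) := by
      simp only [mul_assoc]
    have e5 : X p r * (X i l * D q r) * D j l = X p r * X i l * (D q r * D j l) := by
      simp only [mul_assoc]
    rw [e4, e5, e3, smul_smul, hs]
    simp only [mul_ite, mul_one, mul_zero, ite_mul, zero_mul]
    abel
  simp only [Finset.sum_mul, Finset.mul_sum, term, Finset.sum_add_distrib, Finset.sum_sub_distrib,
    ← Finset.smul_sum]
  congr 1
  · rw [Finset.sum_comm]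
  · congr 1
    · by_cases hjp : j = p
      · simp [hjp]
      · simp [hjp]
    · by_cases hjp : q = i
      · simp [hjp]
      · simp [hjp]

/-! ### A Fock space -/

/-- Formal power series in the variables `(i, l)`. -/
abbrev Pow (k : Type*) [Field k] (n m : ℕ) : Type _ := MvPowerSeries (Idx n m × Idx n m) k

/-- The exterior algebra on the variables `(i, l)`. -/
abbrev Ext (k : Type*) [Field k] (n m : ℕ) : Type _ := ExteriorAlgebra k (Idx n m × Idx n m → k)

/-- The tensor product of the power series and the exterior algebra. -/
abbrev Fock (k : Type*) [Field k] (n m : ℕ) : Type _ := Pow k n m ⊗[k] Ext k n m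

/-- The coordinates of a formal neighbourhood of the identity matrix. -/
def coord (i l : Idx n m) : Pow k n m := (if i = l then 1 else 0) + MvPowerSeries.X (i, l)

/-- Multiplication by an odd variable. -/
def fermi (i l : Idx n m) : Module.End k (Ext k n m) :=
  LinearMap.mulLeft k (ExteriorAlgebra.ι k (Pi.single (i, l) 1))

/-- The derivative with respect to an odd variable. -/
def fermiD (i l : Idx n m) : Module.End k (Ext k n m) :=
  CliffordAlgebra.contractLeft (Q := (0 : QuadraticForm k (Idx n m × Idx n m → k)))
    (LinearMap.proj (i, l))

theorem fermi_apply (i l : Idx n m) (u : Ext k n m) :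
    fermi i l u = ExteriorAlgebra.ι k (Pi.single (i, l) 1) * u := rfl

theorem fermi_mul_fermi (i l j r : Idx n m) :
    (fermi i l * fermi j r : Module.End k (Ext k n m)) = -(fermi j r * fermi i l) := by
  refine LinearMap.ext fun u => ?_
  rw [LinearMap.neg_apply, eq_neg_iff_add_eq_zero]
  have := ExteriorAlgebra.ι_add_mul_swap (R := k)
    (Pi.single (i, l) 1 : Idx n m × Idx n m → k) (Pi.single (j, r) 1)
  rw [Module.End.mul_apply, Module.End.mul_apply, fermi_apply, fermi_apply, fermi_apply,
    fermi_apply, ← mul_assoc, ← mul_assoc, ← add_mul, this, zero_mul]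

theorem fermiD_mul_fermiD (i l j r : Idx n m) :
    (fermiD i l * fermiD j r : Module.End k (Ext k n m)) = -(fermiD j r * fermiD i l) := by
  refine LinearMap.ext fun u => ?_
  exact CliffordAlgebra.contractLeft_comm
    (Q := (0 : QuadraticForm k (Idx n m × Idx n m → k))) _ _ u

theorem fermiD_fermi (i l j r : Idx n m) (u : Ext k n m) :
    fermiD i l (fermi j r u) =
      -(fermi j r (fermiD i l u)) + (if i = j ∧ l = r then (1 : k) else 0) • u := by
  have := CliffordAlgebra.contractLeft_ι_mul
    (Q := (0 : QuadraticForm k (Idx n m × Idx n m → k)))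
    (LinearMap.proj (i, l)) (Pi.single (j, r) 1) u
  simp only [LinearMap.proj_apply, Pi.single_apply, Prod.mk.injEq] at this
  rw [neg_add_eq_sub]
  exact this

theorem pderiv_coord (i l j r : Idx n m) :
    MvPowerSeries.pderiv k (i, l) (coord j r) = if i = j ∧ l = r then 1 else 0 := by
  classical
  have : MvPowerSeries.pderiv k (i, l) (if j = r then 1 else 0) = 0 := by
    split_ifs
    · exact MvPowerSeries.pderiv_one
    · exact map_zero _
  rw [coord, map_add, this, zero_add, MvPowerSeries.pderiv_X, Pi.single_apply]
  simp only [Prod.mk.injEq, eq_comm]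

theorem pderiv_comm (p q : Idx n m × Idx n m) (f : Pow k n m) :
    MvPowerSeries.pderiv k p (MvPowerSeries.pderiv k q f) =
      MvPowerSeries.pderiv k q (MvPowerSeries.pderiv k p f) := by
  by_cases hpq : p = q
  · rw [hpq]
  ext d
  simp only [MvPowerSeries.coeff_pderiv, Finsupp.add_apply, Finsupp.single_apply, hpq,
    Ne.symm hpq, if_false, add_zero]
  rw [add_right_comm]
  ring

/-- The operator on the Fock space given by `f` on the power series if the degree `a` is even and
by `g` on the exterior algebra if it is odd. -/
def fockOp (a : ZMod 2) (f : Module.End k (Pow k n m)) (g : Module.End k (Ext k n m)) :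
    Module.End k (Fock k n m) :=
  if a = 0 then LinearMap.rTensor _ f else LinearMap.lTensor _ g

/-- Even operators act on the first tensor factor and odd ones on the second, so mixed pairs simply
commute. Only equal parities can produce the scalar $c$. -/
theorem fockOp_mul {a b : ZMod 2} {f f' : Module.End k (Pow k n m)}
    {g g' : Module.End k (Ext k n m)} {c : k} (hf : a = 0 → b = 0 → f * f' = f' * f + c • 1)
    (hg : a = 1 → b = 1 → g * g' = -(g' * g) + c • 1) (hc : a ≠ b → c = 0) :
    fockOp a f g * fockOp b f' g' = sgn k a b • (fockOp b f' g' * fockOp a f g) + c • 1 := by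
  rcases zmod_two_cases a with rfl | rfl <;> rcases zmod_two_cases b with rfl | rfl
  · simp only [fockOp, if_true, sgn_zero_left, one_smul]
    rw [← LinearMap.rTensor_mul, hf rfl rfl, LinearMap.rTensor_add, LinearMap.rTensor_mul,
      LinearMap.rTensor_smul, Module.End.one_eq_id, LinearMap.rTensor_id]
    rfl
  · rw [hc zero_ne_one, zero_smul, add_zero, sgn_zero_left, one_smul]
    simp only [fockOp, if_true, one_ne_zero, if_false]
    exact (LinearMap.rTensor_comp_lTensor _ _ _).trans
      (LinearMap.lTensor_comp_rTensor _ _ _).symm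
  · rw [hc one_ne_zero, zero_smul, add_zero, sgn_zero_right, one_smul]
    simp only [fockOp, if_true, one_ne_zero, if_false]
    exact (LinearMap.lTensor_comp_rTensor _ _ _).trans
      (LinearMap.rTensor_comp_lTensor _ _ _).symm
  · have hs : ∀ T : Module.End k (Fock k n m), sgn k 1 1 • T = -T := fun T => by
      rw [sgn_one_one]; exact neg_one_smul k T
    simp only [fockOp, one_ne_zero, if_false, hs]
    rw [← LinearMap.lTensor_mul, hg rfl rfl, LinearMap.lTensor_add, LinearMap.lTensor_neg,
      LinearMap.lTensor_mul,
      LinearMap.lTensor_smul, Module.End.one_eq_id, LinearMap.lTensor_id]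
    rfl

/-- Multiplication by the variable `(i, l)` of the Fock space. -/
def fockX (i l : Idx n m) : Module.End k (Fock k n m) :=
  fockOp (par i + par l) (LinearMap.mulLeft k (coord i l)) (fermi i l)

/-- The derivative with respect to the variable `(i, l)` of the Fock space. -/
def fockD (i l : Idx n m) : Module.End k (Fock k n m) :=
  fockOp (par i + par l) (MvPowerSeries.pderiv k (i, l)).toLinearMap (fermiD i l)

theorem isOscillator_fock :
    IsOscillator (k := k) (n := n) (m := m) (A := Module.End k (Fock k n m)) fockX fockD where
  X_comm i l j r := by
    have := fockOp_mul (k := k) (n := n) (m := m) (a := par i + par l) (b := par j + par r)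
      (f := LinearMap.mulLeft k (coord i l)) (f' := LinearMap.mulLeft k (coord j r))
      (g := fermi i l) (g' := fermi j r) (c := 0) ?_ ?_ fun _ => rfl
    · rwa [zero_smul, add_zero] at this
    · intro _ _
      refine LinearMap.ext fun u => ?_
      simp [mul_left_comm]
    · intro _ _
      rw [zero_smul, add_zero, fermi_mul_fermi]
  D_comm i l j r := by
    have := fockOp_mul (k := k) (n := n) (m := m) (a := par i + par l) (b := par j + par r)
      (f := (MvPowerSeries.pderiv k (i, l)).toLinearMap)
      (f' := (MvPowerSeries.pderiv k (j, r)).toLinearMap)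
      (g := fermiD i l) (g' := fermiD j r) (c := 0) ?_ ?_ fun _ => rfl
    · rwa [zero_smul, add_zero] at this
    · intro _ _
      refine LinearMap.ext fun u => ?_
      simp only [zero_smul, add_zero]
      exact pderiv_comm _ _ u
    · intro _ _
      rw [zero_smul, add_zero, fermiD_mul_fermiD]
  D_X i l j r := by
    have := fockOp_mul (k := k) (n := n) (m := m) (a := par i + par l) (b := par j + par r)
      (f := (MvPowerSeries.pderiv k (i, l)).toLinearMap)
      (f' := LinearMap.mulLeft k (coord j r))
      (g := fermiD i l) (g' := fermi j r) (c := if i = j ∧ l = r then 1 else 0) ?_ ?_ ?_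
    · rwa [ite_smul, one_smul, zero_smul] at this
    · intro _ _
      refine LinearMap.ext fun u => ?_
      change MvPowerSeries.pderiv k (i, l) (coord j r * u) =
        coord j r * MvPowerSeries.pderiv k (i, l) u + (if i = j ∧ l = r then (1 : k) else 0) • u
      rw [Derivation.leibniz, pderiv_coord]
      split_ifs <;> simp
    · intro _ _
      refine LinearMap.ext fun u => ?_
      exact fermiD_fermi i l j r u
    · intro h
      rw [if_neg]
      rintro ⟨rfl, rfl⟩
      exact h rfl

/-! ### Derivations and minors -/

section Det

variable {R ι : Type*} [CommRing R] [Algebra k R] [Fintype ι] [DecidableEq ι]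

theorem derivation_det_eq_zero (D : Derivation k R R) (M : Matrix ι ι R)
    (h : ∀ r s, D (M r s) = 0) : D M.det = 0 := by
  rw [Matrix.det_apply, map_sum]
  refine Finset.sum_eq_zero fun σ _ => ?_
  rw [Units.smul_def, map_zsmul]
  refine (congrArg _ ?_).trans (smul_zero _)
  refine Finset.prod_induction _ (fun x => D x = 0) (fun x y hx hy => ?_) D.map_one_eq_zero
    fun i _ => h _ _
  rw [D.leibniz, hx, hy, smul_zero, smul_zero, add_zero]

/-- In the expansion along row $j$ the cofactors do not involve that row, so $D$ kills them and acts
only on the entries of the row. -/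
theorem derivation_det (D : Derivation k R R) (M : Matrix ι ι R) (j : ι) (v : ι → R)
    (h : ∀ r s, D (M r s) = if r = j then v s else 0) : D M.det = (M.updateRow j v).det := by
  have hadj : ∀ s, D (M.adjugate s j) = 0 := fun s => by
    rw [Matrix.adjugate_apply]
    refine derivation_det_eq_zero D _ fun r t => ?_
    by_cases hr : r = j
    · subst hr
      rw [Matrix.updateRow_self, Pi.single_apply]
      split_ifs
      · exact D.map_one_eq_zero
      · exact map_zero D
    · rw [Matrix.updateRow_ne hr, h, if_neg hr]
  rw [Matrix.det_eq_sum_mul_adjugate_row M j, map_sum,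
    Matrix.det_eq_sum_mul_adjugate_row _ j]
  refine Finset.sum_congr rfl fun s _ => ?_
  rw [D.leibniz, hadj, smul_zero, zero_add, h, if_pos rfl, Matrix.updateRow_self,
    Matrix.adjugate_apply, Matrix.adjugate_apply, Matrix.updateRow_idem, smul_eq_mul, mul_comm]

end Det

theorem par_add_self (i : Idx n m) : par i + par i = 0 := CharTwo.add_self_eq_zero _

theorem par_add_eq_zero_iff (i j : Idx n m) : par i + par j = 0 ↔ par i = par j :=
  CharTwo.add_eq_zero

/-- The vector fields replacing the row `j` by the row `i`. -/
def rowDer (i j : Idx n m) : Derivation k (Pow k n m) (Pow k n m) :=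
  ∑ l, if par i + par l = 0 then (coord i l : Pow k n m) • MvPowerSeries.pderiv k (j, l) else 0

theorem rowDer_apply (i j : Idx n m) (f : Pow k n m) :
    rowDer i j f =
      ∑ l, if par i + par l = 0 then coord i l * MvPowerSeries.pderiv k (j, l) f else 0 := by
  rw [rowDer, ← Derivation.coeFnAddMonoidHom_apply, map_sum, Finset.sum_apply]
  refine Finset.sum_congr rfl fun l _ => ?_
  split_ifs <;> simp

/-- The block diagonal matrix of the even coordinates. -/
def evenBlock (i l : Idx n m) : Pow k n m := if par i + par l = 0 then coord i l else 0

theorem rowDer_evenBlock {i j : Idx n m} (hij : par i = par j) (r s : Idx n m) :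
    rowDer i j (evenBlock r s : Pow k n m) = if r = j then evenBlock i s else 0 := by
  rw [rowDer_apply]
  by_cases hrs : par r + par s = 0
  · simp only [evenBlock, if_pos hrs, pderiv_coord]
    rw [Finset.sum_eq_single s]
    · by_cases hr : r = j
      · subst hr; simp
      · simp [hr, Ne.symm hr]
    · intro l _ hl
      simp [hl]
    · simp
  · simp only [evenBlock, if_neg hrs, map_zero, mul_zero, ite_self, Finset.sum_const_zero]
    split_ifs with h1 h2
    · subst h1
      exact absurd (hij ▸ h2) hrs
    · rfl
    · rfl

/-- The principal minor of the even coordinates on the rows in `S`. -/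
def minorMat (S : Finset (Idx n m)) : Matrix (Idx n m) (Idx n m) (Pow k n m) :=
  fun i l => if i ∈ S then evenBlock i l else (1 : Matrix _ _ _) i l

theorem constantCoeff_coord (i l : Idx n m) :
    MvPowerSeries.constantCoeff (coord i l : Pow k n m) = if i = l then 1 else 0 := by
  rw [coord, map_add, MvPowerSeries.constantCoeff_X, add_zero]
  split_ifs <;> simp

/-- This makes the minors invertible as power series, the reason for centring the coordinates at the
identity matrix. -/
theorem constantCoeff_det_minorMat (S : Finset (Idx n m)) :
    MvPowerSeries.constantCoeff (minorMat S : Matrix _ _ (Pow k n m)).det = 1 := by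
  rw [RingHom.map_det, ← Matrix.det_one (n := Idx n m) (R := k)]
  congr 1
  ext i l
  simp only [RingHom.mapMatrix_apply, Matrix.map_apply, minorMat, evenBlock, Matrix.one_apply]
  have h0 : i = l → par i + par l = 0 := by rintro rfl; exact par_add_self i
  split_ifs with h1 h2 h3 h4 h5
  · rw [constantCoeff_coord, if_pos h3]
  · rw [constantCoeff_coord, if_neg h3]
  · exact absurd (h0 h4) h2
  · rw [map_zero]
  · rw [map_one]
  · rw [map_zero]

/-- A power series which is a highest weight vector of weight `μ` for the even part of
`gl(n|m)`. -/
def IsHighestWeightFun (μ : Idx n m → k) (f : Pow k n m) : Prop :=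
  ∀ i j, par i = par j → (dist n m).symm i ≤ (dist n m).symm j →
    rowDer i j f = (if i = j then μ i else 0) • f

theorem isHighestWeightFun_one : IsHighestWeightFun (0 : Idx n m → k) 1 := by
  intro i j _ _
  simp

theorem IsHighestWeightFun.mul {μ ν : Idx n m → k} {f g : Pow k n m}
    (hf : IsHighestWeightFun μ f) (hg : IsHighestWeightFun ν g) :
    IsHighestWeightFun (μ + ν) (f * g) := by
  intro i j h h'
  rw [Derivation.leibniz, hf i j h h', hg i j h h', smul_eq_mul, smul_eq_mul, mul_smul_comm,
    mul_smul_comm, mul_comm g f, ← add_smul, Pi.add_apply]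
  split_ifs
  · rw [add_comm]
  · rw [add_zero]

theorem IsHighestWeightFun.prod {ι : Type*} (s : Finset ι) {μ : ι → Idx n m → k}
    {f : ι → Pow k n m} (h : ∀ a ∈ s, IsHighestWeightFun (μ a) (f a)) :
    IsHighestWeightFun (∑ a ∈ s, μ a) (∏ a ∈ s, f a) := by
  classical
  induction s using Finset.induction_on with
  | empty => exact isHighestWeightFun_one
  | insert a s ha ih =>
    rw [Finset.sum_insert ha, Finset.prod_insert ha]
    exact (h a (Finset.mem_insert_self a s)).mul
      (ih fun b hb => h b (Finset.mem_insert_of_mem hb))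

theorem IsHighestWeightFun.inv {μ : Idx n m → k} {f : Pow k n m}
    (hf : IsHighestWeightFun μ f) (h0 : MvPowerSeries.constantCoeff f ≠ 0) :
    IsHighestWeightFun (-μ) f⁻¹ := by
  intro i j h h'
  have h1 := MvPowerSeries.inv_mul_cancel f h0
  rw [Derivation.leibniz_of_mul_eq_one _ h1, hf i j h h', smul_eq_mul, mul_smul_comm, sq, neg_mul,
    mul_assoc, h1, mul_one, smul_neg, ← neg_smul, Pi.neg_apply]
  split_ifs <;> simp

/-- The hypothesis `hS` makes $S$ an initial segment of the rows in each parity. Replacing a row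
$j\in S$ by an earlier row $i\ne j$ repeats a row of the minor, and the rows outside $S$ are
constant. -/
theorem isHighestWeightFun_minor (S : Finset (Idx n m))
    (hS : ∀ i j, par i = par j → (dist n m).symm i ≤ (dist n m).symm j → j ∈ S → i ∈ S) :
    IsHighestWeightFun (fun i => if i ∈ S then (1 : k) else 0) (minorMat S).det := by
  intro i j h h'
  by_cases hj : j ∈ S
  · have hi := hS i j h h' hj
    rw [derivation_det (k := k) (R := Pow k n m) (rowDer i j) (minorMat S) j (evenBlock i)]
    · split_ifs with hij
      · subst hij
        simp only [if_pos hi, one_smul]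
        congr 1
        ext r s
        by_cases hr : r = i
        · subst hr
          simp [minorMat, hi]
        · rw [Matrix.updateRow_ne hr]
      · rw [zero_smul]
        refine Matrix.det_zero_of_row_eq hij ?_
        rw [Matrix.updateRow_self, Matrix.updateRow_ne hij]
        ext s
        simp [minorMat, hi]
    · intro r s
      simp only [minorMat, Matrix.one_apply]
      by_cases hr : r ∈ S
      · rw [if_pos hr, rowDer_evenBlock h]
      · rw [if_neg hr, if_neg (fun e : r = j => hr (e ▸ hj))]
        split_ifs <;> simp
  · rw [derivation_det_eq_zero (k := k) (R := Pow k n m) (rowDer i j)]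
    · by_cases hij : i = j
      · subst hij; simp [hj]
      · simp [hij]
    · intro r s
      simp only [minorMat, Matrix.one_apply]
      by_cases hr : r ∈ S
      · rw [if_pos hr, rowDer_evenBlock h, if_neg (fun e : r = j => hj (e ▸ hr))]
      · rw [if_neg hr]
        split_ifs <;> simp

/-- The rows of the minors whose inverses make up the highest weight function. -/
def minorRows (j : Idx n m) : Finset (Idx n m) :=
  Finset.univ.filter fun i => par i = par j ∧
    ((dist n m).symm i < (dist n m).symm j ∨ i = j ∧ par j = 1)

/-- The even block contributes the inverse minors of sizes $0,\dots,n-1$, the odd block those of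
sizes $1,\dots,m$. The shift by one on the odd side is needed because a multiple of the supertrace
changes the two blocks by opposite amounts; `neg_rho_dist` checks the total. -/
theorem exists_isHighestWeightFun : ∃ f : Pow k n m, MvPowerSeries.constantCoeff f = 1 ∧
    IsHighestWeightFun (∑ j, -fun i => if i ∈ minorRows j then (1 : k) else 0) f := by
  refine ⟨∏ j, (minorMat (minorRows j)).det⁻¹, ?_, ?_⟩
  · rw [map_prod]
    refine Finset.prod_eq_one fun j _ => ?_
    rw [MvPowerSeries.constantCoeff_inv, constantCoeff_det_minorMat, inv_one]
  · refine IsHighestWeightFun.prod _ fun j _ => ?_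
    refine (isHighestWeightFun_minor _ ?_).inv ?_
    · intro a b hab hle hb
      simp only [minorRows, Finset.mem_filter, Finset.mem_univ, true_and] at hb ⊢
      refine ⟨hab.trans hb.1, ?_⟩
      rcases hb.2 with h | ⟨rfl, h⟩
      · exact Or.inl (hle.trans_lt h)
      · rcases hle.lt_or_eq with h' | h'
        · exact Or.inl h'
        · exact Or.inr ⟨(dist n m).symm.injective h', h⟩
    · rw [constantCoeff_det_minorMat]
      exact one_ne_zero

/-! ### The exterior algebra -/

/-- The projection on the variables in even rows. -/
def evenRows : (Idx n m × Idx n m → k) →ₗ[k] (Idx n m × Idx n m → k) where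
  toFun f p := if par p.1 = 0 then f p else 0
  map_add' f g := by ext p; by_cases h : par p.1 = 0 <;> simp [h]
  map_smul' c f := by ext p; by_cases h : par p.1 = 0 <;> simp [h]

theorem evenRows_single (i l : Idx n m) :
    evenRows (Pi.single (i, l) (1 : k)) = if par i = 0 then Pi.single (i, l) 1 else 0 := by
  ext p
  by_cases hp : p = (i, l)
  · subst hp
    by_cases h : par i = 0 <;> simp [evenRows, h]
  · by_cases h : par i = 0 <;> simp [evenRows, h, hp]

/-- The endomorphism of the exterior algebra killing the variables in odd rows. -/
def killOddRows : Ext k n m →ₐ[k] Ext k n m := ExteriorAlgebra.map evenRows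

theorem killOddRows_fermi (i l : Idx n m) (u : Ext k n m) :
    killOddRows (fermi i l u) = if par i = 0 then fermi i l (killOddRows u) else 0 := by
  rw [fermi_apply, map_mul, killOddRows, ExteriorAlgebra.map_apply_ι, evenRows_single]
  split_ifs
  · rfl
  · rw [map_zero, zero_mul]

/-- For an even row the coordinate functional is unchanged by composition with `evenRows`, so its
contraction commutes with the induced algebra map. -/
theorem killOddRows_fermiD {i : Idx n m} (hi : par i = 0) (l : Idx n m) (u : Ext k n m) :
    killOddRows (fermiD i l u) = fermiD i l (killOddRows u) := by
  have key : ∀ (x : Idx n m × Idx n m → k) (v : Ext k n m),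
      fermiD i l (ExteriorAlgebra.ι k x * v) =
        x (i, l) • v - ExteriorAlgebra.ι k x * fermiD i l v := fun x v =>
    CliffordAlgebra.contractLeft_ι_mul (Q := (0 : QuadraticForm k (Idx n m × Idx n m → k)))
      (LinearMap.proj (i, l)) x v
  have key0 : ∀ c : k, fermiD i l (algebraMap k (Ext k n m) c) = 0 := fun c =>
    CliffordAlgebra.contractLeft_algebraMap (Q := (0 : QuadraticForm k (Idx n m × Idx n m → k)))
      (LinearMap.proj (i, l)) c
  induction u using CliffordAlgebra.left_induction with
  | algebraMap r =>
    have h1 := key0 r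
    have h2 : killOddRows (algebraMap k (Ext k n m) r) = algebraMap k (Ext k n m) r :=
      killOddRows.commutes r
    exact (congrArg killOddRows h1).trans
      ((map_zero _).trans (h1.symm.trans (congrArg (fermiD i l) h2.symm)))
  | add x y hx hy => rw [map_add, map_add, map_add, map_add, hx, hy]
  | ι_mul u x hu =>
    change killOddRows (fermiD i l (ExteriorAlgebra.ι k x * u)) =
      fermiD i l (killOddRows (ExteriorAlgebra.ι k x * u))
    have hx : evenRows x (i, l) = x (i, l) := if_pos hi
    rw [key, map_sub, map_smul, map_mul, map_mul, hu]
    conv_rhs => rw [killOddRows, ExteriorAlgebra.map_apply_ι, key, hx]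
    rw [killOddRows, ExteriorAlgebra.map_apply_ι]

/-- The vector is the product of the variables in $T$. It is nonzero because differentiating by the
last variable multiplied in gives back the previous product. -/
theorem exists_fermi_vacuum (T : Finset (Idx n m × Idx n m)) (hT : ∀ p ∈ T, par p.1 = 0) :
    ∃ w : Ext k n m, w ≠ 0 ∧ killOddRows w = w ∧ (∀ p ∈ T, fermi p.1 p.2 w = 0) ∧
      ∀ p ∉ T, fermiD p.1 p.2 w = 0 := by
  classical
  induction T using Finset.induction_on with
  | empty =>
    refine ⟨1, one_ne_zero, map_one _, by simp, fun p _ => ?_⟩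
    exact CliffordAlgebra.contractLeft_one (Q := (0 : QuadraticForm k (Idx n m × Idx n m → k)))
      (LinearMap.proj p)
  | insert p T hp ih =>
    obtain ⟨w, hw, hk, h1, h2⟩ := ih fun q hq => hT q (Finset.mem_insert_of_mem hq)
    have hD : ∀ q ≠ p, fermiD q.1 q.2 (fermi p.1 p.2 w) = -fermi p.1 p.2 (fermiD q.1 q.2 w) := by
      intro q hq
      rw [fermiD_fermi, if_neg (fun e => hq (Prod.ext e.1 e.2)), zero_smul, add_zero]
    have hF : ∀ q : Idx n m × Idx n m, fermi q.1 q.2 (fermi p.1 p.2 w) =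
        -fermi p.1 p.2 (fermi q.1 q.2 w) := fun q =>
      LinearMap.congr_fun (fermi_mul_fermi q.1 q.2 p.1 p.2) w
    refine ⟨fermi p.1 p.2 w, ?_, ?_, ?_, ?_⟩
    · intro h
      have := fermiD_fermi p.1 p.2 p.1 p.2 w
      rw [h, map_zero, h2 p hp, map_zero, neg_zero, zero_add, if_pos ⟨rfl, rfl⟩, one_smul] at this
      exact hw this.symm
    · rw [killOddRows_fermi, if_pos (hT p (Finset.mem_insert_self p T)), hk]
    · intro q hq
      rcases Finset.mem_insert.1 hq with rfl | hq
      · rw [fermi_apply, fermi_apply, ← mul_assoc, ExteriorAlgebra.ι_sq_zero, zero_mul]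
      · rw [hF, h1 q hq, map_zero, neg_zero]
    · intro q hq
      rw [Finset.mem_insert, not_or] at hq
      rw [hD q hq.1, h2 q hq.2, map_zero, neg_zero]

/-! ### The action of `gl(n|m)` on the Fock space -/

theorem dist_symm_lt {i j : Idx n m} (hi : par i = 0) (hj : par j = 1) :
    (dist n m).symm i < (dist n m).symm j := by
  rcases i with i | i
  · rcases j with j | j
    · exact absurd hj zero_ne_one
    · rw [Fin.lt_def]
      simp only [dist, Equiv.symm_symm, finSumFinEquiv_apply_left, finSumFinEquiv_apply_right,
        Fin.val_castAdd, Fin.val_natAdd]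
      omega
  · exact absurd hi one_ne_zero

/-- The operators of the matrix units on the Fock space, twisted by `t` times the supertrace. -/
def fockUnits (t : k) (i j : Idx n m) : Module.End k (Fock k n m) :=
  ∑ l, fockX i l * fockD j l +
    if i = j then algebraMap k (Module.End k (Fock k n m)) (sgn k (par i) (par i) * t) else 0

theorem isMatrixUnits_fock (t : k) :
    IsMatrixUnits (k := k) (n := n) (m := m) (A := Module.End k (Fock k n m)) (fockUnits t) :=
  (isOscillator_fock (k := k)).isMatrixUnits.add_str t

theorem fockX_tmul (i l : Idx n m) (f : Pow k n m) (u : Ext k n m) :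
    fockX i l (f ⊗ₜ[k] u) =
      if par i + par l = 0 then (coord i l * f) ⊗ₜ[k] u else f ⊗ₜ[k] fermi i l u := by
  rw [fockX, fockOp]
  split_ifs <;> simp

theorem fockD_tmul (i l : Idx n m) (f : Pow k n m) (u : Ext k n m) :
    fockD i l (f ⊗ₜ[k] u) = if par i + par l = 0 then MvPowerSeries.pderiv k (i, l) f ⊗ₜ[k] u
      else f ⊗ₜ[k] fermiD i l u := by
  rw [fockD, fockOp]
  split_ifs <;> simp

theorem fockUnits_apply (t : k) (i j : Idx n m) (y : Fock k n m) :
    fockUnits t i j y =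
      ∑ l, fockX i l (fockD j l y) + (if i = j then sgn k (par i) (par i) * t else 0) • y := by
  rw [fockUnits, LinearMap.add_apply, LinearMap.sum_apply]
  congr 1
  split_ifs
  · rw [Module.algebraMap_end_apply]
  · simp

theorem sum_par_eq_one (i : Idx n m) (hi : par i = 0) (c : k) :
    (∑ l : Idx n m, if par i + par l = 0 then 0 else c) = m * c := by
  rw [hi, Fintype.sum_sum_type]
  simp [par]

/-- By `hw` and `hw'`, $w$ is full in the odd variables of even rows and empty in those of odd rows.
For equal parities the even coordinates act through `rowDer`, while the odd ones count the $m$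
filled variables of an even row. For $i$ even and $j$ odd, each summand either multiplies by a
filled variable or differentiates by an empty one. -/
theorem fockUnits_tmul_of_le (t : k) {μ : Idx n m → k} {f : Pow k n m}
    (hf : IsHighestWeightFun μ f) {w : Ext k n m}
    (hw : ∀ a l, par a = 0 → par l = 1 → fermi a l w = 0)
    (hw' : ∀ a l, par a = 1 → par l = 0 → fermiD a l w = 0) {i j : Idx n m}
    (hij : (dist n m).symm i ≤ (dist n m).symm j) :
    fockUnits t i j (f ⊗ₜ[k] w) =
      (if i = j then μ i + (if par i = 0 then (m : k) else 0) + sgn k (par i) (par i) * t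
        else 0) • (f ⊗ₜ[k] w) := by
  have h11 : (1 : ZMod 2) + 1 = 0 := rfl
  rw [fockUnits_apply]
  by_cases hp : par i = par j
  · have term : ∀ l, fockX i l (fockD j l (f ⊗ₜ[k] w)) =
        (if par i + par l = 0 then coord i l * MvPowerSeries.pderiv k (j, l) f else 0) ⊗ₜ[k] w +
        (if par i + par l = 0 then 0 else (if par i = 0 ∧ i = j then (1 : k) else 0)) •
          (f ⊗ₜ[k] w) := by
      intro l
      rw [fockD_tmul, ← hp]
      split_ifs with h1 h2
      · rw [fockX_tmul, if_pos h1, zero_smul, add_zero]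
      · rw [fockX_tmul, if_neg h1, TensorProduct.zero_tmul, zero_add, one_smul]
        have hl : par l = 1 := by
          rcases zmod_two_cases (par l) with h | h
          · exact absurd (by rw [h2.1, h, add_zero]) h1
          · exact h
        have := fermiD_fermi j l i l w
        rw [hw i l h2.1 hl, map_zero, if_pos ⟨h2.2.symm, rfl⟩, one_smul] at this
        rw [neg_add_eq_zero.1 this.symm]
      · rw [fockX_tmul, if_neg h1, TensorProduct.zero_tmul, zero_add, zero_smul]
        rcases zmod_two_cases (par i) with hi | hi
        · have hl : par l = 1 := by
            rcases zmod_two_cases (par l) with h | h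
            · exact absurd (by rw [hi, h, add_zero]) h1
            · exact h
          have := fermiD_fermi j l i l w
          rw [hw i l hi hl, map_zero, if_neg (fun e => h2 ⟨hi, e.1.symm⟩), zero_smul, add_zero,
            eq_comm, neg_eq_zero] at this
          rw [this, TensorProduct.tmul_zero]
        · have hl : par l = 0 := by
            rcases zmod_two_cases (par l) with h | h
            · exact h
            · exact absurd (by rw [hi, h, h11]) h1
          rw [hw' j l (hp ▸ hi) hl, map_zero, TensorProduct.tmul_zero]
    rw [Finset.sum_congr rfl fun l _ => term l, Finset.sum_add_distrib, ← TensorProduct.sum_tmul,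
      ← rowDer_apply, hf i j hp hij, ← Finset.sum_smul, ← TensorProduct.smul_tmul', ← add_smul,
      ← add_smul]
    congr 1
    by_cases e : i = j
    · subst e
      simp only [if_true, and_true]
      rcases zmod_two_cases (par i) with hi | hi
      · rw [if_pos hi, if_pos hi, sum_par_eq_one i hi, mul_one]
      · simp [hi]
    · simp [e]
  · have hi : par i = 0 ∧ par j = 1 := by
      rcases zmod_two_cases (par i) with hi | hi <;> rcases zmod_two_cases (par j) with hj | hj
      · exact absurd (hi.trans hj.symm) hp
      · exact ⟨hi, hj⟩
      · exact absurd hij (dist_symm_lt hj hi).not_ge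
      · exact absurd (hi.trans hj.symm) hp
    have hne : i ≠ j := fun e => hp (e ▸ rfl)
    rw [if_neg hne, if_neg hne, zero_smul, add_zero]
    refine Finset.sum_eq_zero fun l _ => ?_
    rw [fockD_tmul, hi.2]
    rcases zmod_two_cases (par l) with hl | hl
    · rw [hl, add_zero, if_neg one_ne_zero, hw' j l hi.2 hl, TensorProduct.tmul_zero, map_zero]
    · rw [hl, h11, if_pos rfl, fockX_tmul, hi.1, hl, zero_add, if_neg one_ne_zero,
        hw i l hi.1 hl, TensorProduct.tmul_zero]

/-- The evaluation of a vector of the Fock space at the identity matrix, killing the odd variables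
in the odd rows. -/
def fockEval : Fock k n m →ₗ[k] Ext k n m :=
  (TensorProduct.lid k (Ext k n m)).toLinearMap ∘ₗ
    TensorProduct.map (MvPowerSeries.coeff 0) killOddRows.toLinearMap

theorem fockEval_tmul (f : Pow k n m) (u : Ext k n m) :
    fockEval (f ⊗ₜ[k] u) = MvPowerSeries.constantCoeff f • killOddRows u := by
  simp [fockEval]

/-- In $\sum_l X_{cl}D_{al}$ an even $l$ gives an odd variable in the odd row $c$, which is killed.
An odd $l$ gives a coordinate whose value at the identity is $\delta_{cl}$, so only $l=c$ survives.
-/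
theorem fockEval_fockUnits (t : k) {c a : Idx n m} (hc : par c = 1) (ha : par a = 0)
    (y : Fock k n m) : fockEval (fockUnits t c a y) = fermiD a c (fockEval y) := by
  have hca : c ≠ a := fun e => zero_ne_one (ha.symm.trans (e ▸ hc))
  have h11 : (1 : ZMod 2) + 1 = 0 := rfl
  rw [fockUnits_apply, if_neg hca, zero_smul, add_zero]
  induction y using TensorProduct.induction_on with
  | zero => simp
  | add x y hx hy =>
    simp only [map_add, Finset.sum_add_distrib] at hx hy ⊢
    rw [hx, hy]
  | tmul f u =>
    rw [map_sum, Finset.sum_eq_single c]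
    · rw [fockD_tmul, ha, hc, zero_add, if_neg one_ne_zero, fockX_tmul, hc, h11, if_pos rfl,
        fockEval_tmul, fockEval_tmul, map_mul, constantCoeff_coord, if_pos rfl, one_mul, map_smul,
        killOddRows_fermiD ha]
    · intro l _ hl
      rw [fockD_tmul, ha, zero_add]
      rcases zmod_two_cases (par l) with h | h
      · rw [if_pos h, fockX_tmul, hc, h, add_zero, if_neg one_ne_zero, fockEval_tmul,
          killOddRows_fermi, if_neg (by rw [hc]; exact one_ne_zero), smul_zero]
      · rw [h, if_neg one_ne_zero, fockX_tmul, hc, h, h11, if_pos rfl, fockEval_tmul, map_mul,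
          constantCoeff_coord, if_neg hl.symm, zero_mul, zero_smul]
    · simp

/-! ### The vector `ρ` -/

/-- The sign comparing the positions of two indices in the one line notation `w`. -/
def posSign (k : Type*) [Field k] (w : Fin (n + m) ≃ Idx n m) (i j : Idx n m) : k :=
  if w.symm i < w.symm j then 1 else if w.symm j < w.symm i then -1 else 0

/-- The sign comparing the parities of two indices. -/
def parSign (k : Type*) [Field k] (i j : Idx n m) : k := if par i = par j then 1 else -1

theorem sum_eps_sub_eps (w : Fin (n + m) ≃ Idx n m) (P : Idx n m → Idx n m → Prop)
    [∀ a b, Decidable (P a b)] (hP : ∀ a b, P a b ↔ P b a) (i : Idx n m) :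
    ∑ p : Idx n m × Idx n m with w.symm p.1 < w.symm p.2 ∧ P p.1 p.2,
      (((eps p.1 - eps p.2) i : ℤ) : k) = ∑ j, if P i j then posSign k w i j else 0 := by
  have h1 : ∀ a b : Idx n m, (if w.symm a < w.symm b ∧ P a b then
      (((eps a - eps b) i : ℤ) : k) else 0) =
      (if i = a then (if w.symm i < w.symm b ∧ P i b then 1 else 0) else 0) -
        (if i = b then (if w.symm a < w.symm i ∧ P i a then 1 else 0) else 0) := by
    intro a b
    simp only [Pi.sub_apply, eps, Pi.single_apply]
    by_cases ha : i = a <;> by_cases hb : i = b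
    · subst ha; subst hb; simp
    · subst ha; simp [hb]
    · subst hb; simp only [ha, if_false, if_true, hP a i, zero_sub]
      split_ifs <;> simp
    · simp [ha, hb]
  rw [Finset.sum_filter, Fintype.sum_prod_type]
  simp only [h1, Finset.sum_sub_distrib, Finset.sum_ite_eq, Finset.mem_univ, if_true]
  rw [Finset.sum_comm]
  simp only [Finset.sum_ite_eq, Finset.mem_univ, if_true]
  rw [← Finset.sum_sub_distrib]
  refine Finset.sum_congr rfl fun j _ => ?_
  unfold posSign
  by_cases h : P i j
  · rcases lt_trichotomy (w.symm i) (w.symm j) with h' | h' | h'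
    · simp [h, h', h'.not_gt]
    · simp [h, h']
    · simp [h, h', h'.not_gt]
  · simp [h]

theorem rho_apply (w : Fin (n + m) ≃ Idx n m) (i : Idx n m) :
    rho k w i = (1 / 2) * ∑ j, parSign k i j * posSign k w i j := by
  rw [rho, Pi.sub_apply, rho0, rho1, sum_eps_sub_eps w (fun a b => par a = par b)
    (fun _ _ => eq_comm), sum_eps_sub_eps w (fun a b => par a ≠ par b) (fun _ _ => ne_comm),
    ← mul_sub, ← Finset.sum_sub_distrib]
  congr 1
  refine Finset.sum_congr rfl fun j _ => ?_
  unfold parSign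
  by_cases h : par i = par j <;> simp [h]

theorem parSign_eq_neg {i j : Idx n m} (h : par i ≠ par j) (l : Idx n m) :
    parSign k i l = -parSign k j l := by
  unfold parSign
  rcases zmod_two_cases (par i) with hi | hi <;> rcases zmod_two_cases (par j) with hj | hj <;>
    rcases zmod_two_cases (par l) with hl | hl <;> simp_all

/-- This is $(\rho,\alpha)=0$ for an isotropic simple root; the form has opposite signs on the two
blocks, so the pairing is a sum of coordinates. Any other index lies on the same side of both
adjacent positions but has opposite parity signs relative to them, so it contributes nothing. -/
theorem rho_add_rho_eq_zero (w : Fin (n + m) ≃ Idx n m) {s t : Fin (n + m)}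
    (hst : (s : ℕ) + 1 = t) (hp : par (w s) ≠ par (w t)) : rho k w (w s) + rho k w (w t) = 0 := by
  rw [rho_apply, rho_apply, ← mul_add, ← Finset.sum_add_distrib]
  have h0 : ∀ l, parSign k (w s) l * posSign k w (w s) l + parSign k (w t) l * posSign k w (w t) l =
      (if l = w t then parSign k (w s) (w t) else 0) -
        (if l = w s then parSign k (w t) (w s) else 0) := by
    intro l
    obtain ⟨a, rfl⟩ := w.surjective l
    have hlt : s < t := by rw [Fin.lt_def]; omega
    simp only [posSign, Equiv.symm_apply_apply, EmbeddingLike.apply_eq_iff_eq]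
    by_cases h1 : a = t
    · subst h1
      simp [hlt, hlt.ne']
    by_cases h2 : a = s
    · subst h2
      simp [hlt, hlt.ne, hlt.not_gt]
    rw [parSign_eq_neg hp (w a), if_neg h1, if_neg h2]
    rcases lt_trichotomy a s with h | h | h
    · have : a < t := h.trans hlt
      simp [h, this, h.not_gt, this.not_gt]
    · exact absurd h h2
    · have : t < a := by
        rw [Fin.lt_def] at h ⊢
        have := fun e => h1 (Fin.ext e)
        omega
      simp [h, this]
  simp only [h0, Finset.sum_sub_distrib, Finset.sum_ite_eq', Finset.mem_univ, if_true]
  simp only [parSign, if_neg hp, if_neg hp.symm, sub_self, mul_zero]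

/-- The one line notation in which the entries in positions `s` and `t` are exchanged. -/
def swapAt (w : Fin (n + m) ≃ Idx n m) (s t : Fin (n + m)) : Fin (n + m) ≃ Idx n m :=
  (Equiv.swap s t).trans w

theorem swapAt_symm_apply (w : Fin (n + m) ≃ Idx n m) (s t a : Fin (n + m)) :
    (swapAt w s t).symm (w a) = Equiv.swap s t a := by
  simp [swapAt]

theorem swap_lt_swap_iff {N : ℕ} {s t a b : Fin N} (hst : (s : ℕ) + 1 = t)
    (h1 : ¬ (a = s ∧ b = t)) (h2 : ¬ (a = t ∧ b = s)) :
    Equiv.swap s t a < Equiv.swap s t b ↔ a < b := by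
  simp only [Equiv.swap_apply_def, Fin.ext_iff, Fin.lt_def] at *
  split_ifs <;> omega

/-- Only the pair at positions $s,t$ changes order: the positive odd root $\alpha$ is replaced by
$-\alpha$, which lowers $\rho_1$ by $\alpha$. -/
theorem rho_swapAt [CharZero k] (w : Fin (n + m) ≃ Idx n m) {s t : Fin (n + m)}
    (hst : (s : ℕ) + 1 = t)
    (hp : par (w s) ≠ par (w t)) (i : Idx n m) :
    rho k (swapAt w s t) i = rho k w i + (((eps (w s) - eps (w t)) i : ℤ) : k) := by
  have hlt : s < t := by rw [Fin.lt_def]; omega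
  have h0 : ∀ a b, posSign k (swapAt w s t) (w a) (w b) = posSign k w (w a) (w b) -
      (if a = s ∧ b = t then 2 else 0) + (if a = t ∧ b = s then 2 else 0) := by
    intro a b
    simp only [posSign, swapAt_symm_apply, Equiv.symm_apply_apply]
    by_cases h1 : a = s ∧ b = t
    · obtain ⟨rfl, rfl⟩ := h1
      simp [hlt, hlt.ne, hlt.not_gt]
      norm_num
    by_cases h2 : a = t ∧ b = s
    · obtain ⟨rfl, rfl⟩ := h2
      simp [hlt, hlt.ne', hlt.not_gt]
      norm_num
    simp only [swap_lt_swap_iff hst h1 h2, swap_lt_swap_iff hst (fun e => h2 ⟨e.2, e.1⟩)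
      (fun e => h1 ⟨e.2, e.1⟩), if_neg h1, if_neg h2, sub_zero, add_zero]
  obtain ⟨a, rfl⟩ := w.surjective i
  rw [rho_apply, rho_apply, ← Equiv.sum_comp w, ← Equiv.sum_comp w]
  simp only [h0, mul_add, mul_sub, Finset.sum_add_distrib, Finset.sum_sub_distrib]
  simp only [Pi.sub_apply, eps, Pi.single_apply, EmbeddingLike.apply_eq_iff_eq]
  by_cases h1 : a = s
  · subst h1
    simp [hlt.ne, parSign, hp]
  by_cases h2 : a = t
  · subst h2
    simp [hlt.ne', parSign, hp.symm]
  simp [h1, h2]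

/-- The three summands are the weights of the inverse minors, of the odd variables and of the
supertrace twist. Compared with $-\rho$, the minors alone are off by $-(n+m-1)/2$ in even rows and
by $(n-m-1)/2$ in odd rows; the other two summands cancel this. -/
theorem neg_rho_dist [CharZero k] (i : Idx n m) :
    (∑ j, -fun i => if i ∈ minorRows j then (1 : k) else 0) i + (if par i = 0 then (m : k) else 0) +
      sgn k (par i) (par i) * (((n : k) - m - 1) / 2) = -rho k (dist n m) i := by
  rw [rho_apply, Finset.sum_apply]
  rcases zmod_two_cases (par i) with hi | hi
  · have h0 : ∀ j, (-fun i => if i ∈ minorRows j then (1 : k) else 0) i =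
        -(1 / 2 * (parSign k i j * posSign k (dist n m) i j)) - 1 / 2 +
          (if i = j then 1 / 2 else 0) := by
      intro j
      simp only [Pi.neg_apply, minorRows, Finset.mem_filter, Finset.mem_univ, true_and, parSign,
        posSign, hi]
      rcases zmod_two_cases (par j) with hj | hj
      · rcases lt_trichotomy ((dist n m).symm i) ((dist n m).symm j) with h | h | h
        · have : i ≠ j := fun e => h.ne (congrArg _ e)
          simp [hj, h, this]; norm_num
        · have := (dist n m).symm.injective h
          subst this
          simp [hj]
        · have : i ≠ j := fun e => h.ne (congrArg _ e.symm)
          simp [hj, h, this, h.not_gt]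
      · have := dist_symm_lt hi hj
        have hne : i ≠ j := fun e => this.ne (congrArg _ e)
        simp [hj, this, hne]
    simp only [h0, Finset.sum_add_distrib, Finset.sum_sub_distrib, Finset.sum_neg_distrib,
      ← Finset.mul_sum, Finset.sum_ite_eq, Finset.mem_univ, if_true, hi, sgn_zero_left,
      Finset.sum_const, Finset.card_univ, Fintype.card_sum, Fintype.card_fin, nsmul_eq_mul]
    push_cast
    ring
  · have h0 : ∀ j, (-fun i => if i ∈ minorRows j then (1 : k) else 0) i =
        -(1 / 2 * (parSign k i j * posSign k (dist n m) i j)) -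
          (if par j = 0 then -(1 / 2) else 1 / 2) - (if i = j then 1 / 2 else 0) := by
      intro j
      simp only [Pi.neg_apply, minorRows, Finset.mem_filter, Finset.mem_univ, true_and, parSign,
        posSign, hi]
      rcases zmod_two_cases (par j) with hj | hj
      · have := dist_symm_lt hj hi
        have hne : i ≠ j := fun e => this.ne (congrArg _ e.symm)
        simp [hj, this, hne, this.not_gt]
      · rcases lt_trichotomy ((dist n m).symm i) ((dist n m).symm j) with h | h | h
        · have : i ≠ j := fun e => h.ne (congrArg _ e)
          simp [hj, h, this]; norm_num
        · have := (dist n m).symm.injective h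
          subst this
          simp [hj]; norm_num
        · have : i ≠ j := fun e => h.ne (congrArg _ e.symm)
          simp [hj, h, this, h.not_gt]
    have h1 : ∑ j : Idx n m, (if par j = 0 then -(1 / 2) else 1 / 2 : k) = (m - n) / 2 := by
      rw [Fintype.sum_sum_type]
      simp [par]
      ring
    simp only [h0, Finset.sum_sub_distrib, Finset.sum_neg_distrib, h1,
      ← Finset.mul_sum, Finset.sum_ite_eq, Finset.mem_univ, if_true, hi, sgn_one_one, one_ne_zero,
      if_false]
    ring

/-! ### Borel subalgebras and odd reflections -/

theorem eps_sub_eps_inj {i j a b : Idx n m} (hij : i ≠ j)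
    (h : (eps i - eps j : Idx n m → ℤ) = eps a - eps b) : i = a ∧ j = b := by
  have hi := congrFun h i
  have hj := congrFun h j
  simp only [Pi.sub_apply, eps, Pi.single_apply, if_true, if_neg hij, if_neg hij.symm] at hi hj
  constructor
  · by_contra hne
    rw [if_neg hne] at hi
    split_ifs at hi <;> omega
  · by_contra hne
    rw [if_neg hne] at hj
    split_ifs at hj <;> omega

theorem eq_of_forall_lt {w w' : Fin (n + m) ≃ Idx n m}
    (h : ∀ a b : Fin (n + m), a < b → w'.symm (w a) < w'.symm (w b)) : w = w' := by
  have hmono : StrictMono (w.trans w'.symm) := fun a b hab => h a b hab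
  let e : Fin (n + m) ≃o Fin (n + m) := hmono.orderIsoOfSurjective _ (w.trans w'.symm).surjective
  have he : e = OrderIso.refl _ := Subsingleton.elim _ _
  ext a
  have : w'.symm (w a) = a := congrArg (fun f : Fin (n + m) ≃o Fin (n + m) => f a) he
  rw [← w'.apply_symm_apply (w a), this]

theorem single_mem_borel_iff {g : LieSubsuperalgebra k n m}
    (hg : ∀ i j : Idx n m, i ≠ j → Matrix.single i j 1 ∈ g.toSubmodule)
    (w : Fin (n + m) ≃ Idx n m) {i j : Idx n m} (hij : i ≠ j) :
    Matrix.single i j 1 ∈ (borel g w).toSubmodule ↔ w.symm i < w.symm j := by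
  constructor
  · intro h
    by_contra h'
    have hlt : w.symm j < w.symm i :=
      lt_of_le_of_ne (not_lt.1 h') fun e => hij (w.symm.injective e.symm)
    have := h.2 i j hlt
    simp at this
  · intro h
    refine ⟨hg i j hij, fun a b hab => ?_⟩
    rw [Matrix.single_apply_of_ne]
    rintro ⟨rfl, rfl⟩
    exact absurd hab h.not_gt

theorem borel_injective {g : LieSubsuperalgebra k n m}
    (hg : ∀ i j : Idx n m, i ≠ j → Matrix.single i j 1 ∈ g.toSubmodule)
    {w w' : Fin (n + m) ≃ Idx n m} (h : borel g w = borel g w') : w = w' := by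
  refine eq_of_forall_lt fun a b hab => ?_
  have hne : w a ≠ w b := fun e => hab.ne (w.injective e)
  rw [← single_mem_borel_iff hg w' hne, ← h, single_mem_borel_iff hg w hne]
  simpa using hab

/-- On simple roots the odd reflection is the transposition of two adjacent entries: only the
neighbours of $\alpha$ in the diagram absorb it. -/
theorem reflect_simpleRoot (w : Fin (n + m) ≃ Idx n m) {s t c d : Fin (n + m)}
    (hst : (s : ℕ) + 1 = t) (hcd : (c : ℕ) + 1 = d) :
    reflect (eps (w s) - eps (w t)) (eps (w c) - eps (w d)) =
      eps (swapAt w s t c) - eps (swapAt w s t d) := by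
  have hst' : s ≠ t := by rintro rfl; omega
  have hcd' : c ≠ d := by rintro rfl; omega
  have hw : ∀ x, swapAt w s t x = w (Equiv.swap s t x) := fun _ => rfl
  rw [hw, hw]
  by_cases h1 : c = s
  · subst h1
    obtain rfl : d = t := Fin.ext (hcd.symm.trans hst)
    rw [reflect, if_pos rfl, Equiv.swap_apply_left, Equiv.swap_apply_right, neg_sub]
  have hne : (eps (w c) - eps (w d) : Idx n m → ℤ) ≠ eps (w s) - eps (w t) := fun e =>
    h1 (w.injective (eps_sub_eps_inj (fun e => hcd' (w.injective e)) e).1)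
  have hdt : d ≠ t := fun e => h1 (Fin.ext (by omega))
  rw [reflect, if_neg hne]
  by_cases h2 : d = s
  · subst h2
    have hct : c ≠ t := by rintro rfl; omega
    rw [Equiv.swap_apply_left, Equiv.swap_apply_of_ne_of_ne h1 hct]
    have : (eps (w d) - eps (w t) + (eps (w c) - eps (w d)) : Idx n m → ℤ) =
        eps (w c) - eps (w t) := by abel
    rw [this, if_pos ⟨_, _, fun e => hct (w.injective e), rfl⟩]
  by_cases h3 : c = t
  · subst h3
    rw [Equiv.swap_apply_right, Equiv.swap_apply_of_ne_of_ne h2 hdt]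
    have : (eps (w s) - eps (w c) + (eps (w c) - eps (w d)) : Idx n m → ℤ) =
        eps (w s) - eps (w d) := by abel
    rw [this, if_pos ⟨_, _, fun e => h2 (w.injective e).symm, rfl⟩]
  rw [Equiv.swap_apply_of_ne_of_ne h1 h3, Equiv.swap_apply_of_ne_of_ne h2 hdt, if_neg]
  -- For a non-neighbour, $\alpha+\beta$ has coordinate $+1$ at two distinct indices, which no root
  -- has.
  rintro ⟨i, j, hij, h⟩
  have hs := congrFun h (w s)
  have hc := congrFun h (w c)
  simp only [Pi.add_apply, Pi.sub_apply, eps, Pi.single_apply, EmbeddingLike.apply_eq_iff_eq,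
    if_true, if_neg hst', if_neg h1, if_neg (Ne.symm h1), if_neg h3, if_neg hcd',
    if_neg (Ne.symm h2)] at hs hc
  have hsi : w s = i := by
    by_contra hne
    rw [if_neg hne] at hs
    split_ifs at hs <;> omega
  have hci : w c = i := by
    by_contra hne
    rw [if_neg hne] at hc
    split_ifs at hc <;> omega
  exact h1 (w.injective (hci.trans hsi.symm))

/-- The simple roots record which entries follow each other, and this determines the ordering. -/
theorem eq_swapAt_of_simpleRoots {w w' : Fin (n + m) ≃ Idx n m} {s t : Fin (n + m)}
    (hst : (s : ℕ) + 1 = t)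
    (h : simpleRoots w' = reflect (eps (w s) - eps (w t)) '' simpleRoots w) :
    w' = swapAt w s t := by
  have step : ∀ a b : Fin (n + m), (a : ℕ) + 1 = b →
      (swapAt w s t).symm (w' a) < (swapAt w s t).symm (w' b) := by
    intro a b hab
    have hmem : (eps (w' a) - eps (w' b) : Idx n m → ℤ) ∈ simpleRoots w' := ⟨a, b, hab, rfl⟩
    rw [h] at hmem
    obtain ⟨_, ⟨c, d, hcd, rfl⟩, he⟩ := hmem
    rw [reflect_simpleRoot w hst hcd] at he
    have hab' : w' a ≠ w' b := fun e => by
      have := w'.injective e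
      subst this
      omega
    obtain ⟨ha, hb⟩ := eps_sub_eps_inj hab' he.symm
    rw [ha, hb, Equiv.symm_apply_apply, Equiv.symm_apply_apply, Fin.lt_def]
    omega
  refine eq_of_forall_lt fun a b hab => ?_
  have : ∀ (l : ℕ) (b : Fin (n + m)), (b : ℕ) = a + l + 1 →
      (swapAt w s t).symm (w' a) < (swapAt w s t).symm (w' b) := by
    intro l
    induction l with
    | zero => exact fun b hb => step a b hb.symm
    | succ l ih =>
      intro b hb
      exact (ih ⟨a + l + 1, by omega⟩ rfl).trans (step _ _ (by simp only; omega))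
  exact this (b - a - 1) b (by rw [Fin.lt_def] at hab; omega)

/-! ### Root spaces and the odd reflection crossed by a root. -/

theorem sum_comp (x : Mat k n m) : ∑ p, comp p x = x := by
  ext i j
  rw [Matrix.sum_apply]
  simp [comp]

theorem superBracket_diagonal (d : Idx n m → k) (x : Mat k n m) :
    superBracket (Matrix.diagonal d) x = Matrix.diagonal d * x - x * Matrix.diagonal d := by
  unfold superBracket
  have h := (isHomog_diagonal (m := m) (n := n) d).comp_eq
  rw [Finset.sum_eq_single 0]
  · simp only [h, if_true, sgn_zero_left, one_smul, Finset.sum_sub_distrib, ← Finset.mul_sum,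
      ← Finset.sum_mul, sum_comp]
  · intro b _ hb
    simp [h, hb]
  · simp

theorem single_mem_rootSpace {g : LieSubsuperalgebra k n m} {i j : Idx n m}
    (h : Matrix.single i j 1 ∈ g.toSubmodule) :
    (Matrix.single i j 1 : Mat k n m) ∈ rootSpace g (eps i - eps j) := by
  refine ⟨h, fun d => ?_⟩
  rw [superBracket_diagonal]
  have hs : ∑ l, (((eps i - eps j : Idx n m → ℤ) l : ℤ) : k) * d l = d i - d j := by
    simp [eps, Pi.single_apply, sub_mul, Finset.sum_sub_distrib]
  rw [hs]
  ext a b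
  simp only [Matrix.sub_apply, Matrix.diagonal_mul, Matrix.mul_diagonal, Matrix.smul_apply,
    smul_eq_mul]
  by_cases hab : i = a ∧ j = b
  · obtain ⟨rfl, rfl⟩ := hab; simp
  · simp [Matrix.single_apply_of_ne _ _ _ _ _ hab]

theorem exists_smul_single_of_mem_rootSpace {g : LieSubsuperalgebra k n m} {i j : Idx n m}
    (hij : i ≠ j) {x : Mat k n m} [CharZero k] (hx : x ∈ rootSpace g (eps i - eps j)) :
    x = x i j • Matrix.single i j 1 := by
  ext a b
  rw [Matrix.smul_apply, smul_eq_mul]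
  by_cases hab : i = a ∧ j = b
  · obtain ⟨rfl, rfl⟩ := hab; simp
  rw [Matrix.single_apply_of_ne _ _ _ _ _ hab, mul_zero]
  have key : ∀ d : Idx n m → k, (d a - d b) * x a b = (d i - d j) * x a b := by
    intro d
    have := congrFun (congrFun (hx.2 d) a) b
    have hs : ∑ l, (((eps i - eps j : Idx n m → ℤ) l : ℤ) : k) * d l = d i - d j := by
      simp [eps, Pi.single_apply, sub_mul, Finset.sum_sub_distrib]
    rw [superBracket_diagonal, hs] at this
    simp only [Matrix.sub_apply, Matrix.diagonal_mul, Matrix.mul_diagonal, Matrix.smul_apply,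
      smul_eq_mul] at this
    rw [← this]; ring
  by_contra h0
  have key' : ∀ d : Idx n m → k, d a - d b = d i - d j := fun d => mul_right_cancel₀ h0 (key d)
  -- Testing on the coordinate vectors at $i$ and $j$ separates this root from all other pairs;
  -- characteristic zero excludes $-1=1$.
  have hi := key' (Pi.single i 1)
  have hj := key' (Pi.single j 1)
  simp only [Pi.single_apply, if_true, if_neg hij, if_neg hij.symm] at hi hj
  refine hab ⟨?_, ?_⟩
  · by_contra hne
    rw [if_neg (Ne.symm hne)] at hi
    split_ifs at hi <;> norm_num at hi
  · by_contra hne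
    rw [if_neg (Ne.symm hne)] at hj
    split_ifs at hj <;> norm_num at hj

/-- Adjacency only supplies some orderings, so the given one is identified through
`borel_injective`. The transposed pair is the only one whose order changes, hence it is the pair of
$\beta$; positivity for the distinguished Borel puts the even index first. -/
theorem Adjacent.exists_swapAt {g b' : LieSubsuperalgebra k n m}
    (hg : ∀ i j : Idx n m, i ≠ j → Matrix.single i j 1 ∈ g.toSubmodule)
    {w : Fin (n + m) ≃ Idx n m} {β : Idx n m → ℤ}
    (h : Adjacent g (borel g w) b') (hodd : IsOddRoot β) (hpos : β ∈ positiveRoots (dist n m))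
    (h1 : rootSpace g β ⊆ (borel g w).toSubmodule) (h2 : rootSpace g (-β) ⊆ b'.toSubmodule) :
    ∃ s t : Fin (n + m), (s : ℕ) + 1 = t ∧ par (w s) = 0 ∧ par (w t) = 1 ∧
      β = eps (w s) - eps (w t) ∧ b' = borel g (swapAt w s t) := by
  obtain ⟨w₁, w', α, hw₁, rfl, ⟨s, t, hst, rfl⟩, -, hw'⟩ := h
  obtain rfl := borel_injective hg hw₁
  obtain rfl := eq_swapAt_of_simpleRoots hst hw'
  obtain ⟨i, j, hp, rfl⟩ := hodd
  have hij : i ≠ j := fun e => hp (congrArg _ e)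
  obtain ⟨a, b, hab, he⟩ := hpos
  obtain ⟨hia, hjb⟩ := eps_sub_eps_inj hij he
  have hlt : (dist n m).symm i < (dist n m).symm j := by
    rw [hia, hjb, Equiv.symm_apply_apply, Equiv.symm_apply_apply]
    exact hab
  have hpar : par i = 0 ∧ par j = 1 := by
    rcases zmod_two_cases (par i) with hi | hi <;> rcases zmod_two_cases (par j) with hj | hj
    · exact absurd (hi.trans hj.symm) hp
    · exact ⟨hi, hj⟩
    · exact absurd hlt (dist_symm_lt hj hi).not_gt
    · exact absurd (hi.trans hj.symm) hp
  have l1 := (single_mem_borel_iff hg w hij).1 (h1 (single_mem_rootSpace (hg i j hij)))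
  have l2 := (single_mem_borel_iff hg (swapAt w s t) hij.symm).1
    (h2 (by rw [neg_sub]; exact single_mem_rootSpace (hg j i hij.symm)))
  obtain ⟨c, rfl⟩ := w.surjective i
  obtain ⟨d, rfl⟩ := w.surjective j
  rw [Equiv.symm_apply_apply, Equiv.symm_apply_apply] at l1
  rw [swapAt_symm_apply, swapAt_symm_apply] at l2
  have hc : c = s ∧ d = t := by
    by_contra hne
    by_cases hne' : c = t ∧ d = s
    · rw [hne'.1, hne'.2, Fin.lt_def] at l1
      omega
    · exact absurd ((swap_lt_swap_iff hst hne hne').2 l1) l2.not_gt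
  obtain ⟨rfl, rfl⟩ := hc
  exact ⟨c, d, hst, hpar.1, hpar.2, rfl, rfl⟩

/-! ### Highest weight vectors under odd reflections -/

theorem eq_zero_of_eq_neg_one_smul {k : Type*} [Field k] [CharZero k] {N : Type*}
    [AddCommMonoid N] [Module k N] {x : N} (h : x = (-1 : k) • x) : x = 0 := by
  have h2 : (2 : k) • x = 0 := by
    rw [two_smul]
    nth_rewrite 1 [h]
    nth_rewrite 2 [← one_smul k x]
    rw [← add_smul, neg_add_cancel, zero_smul]
  rw [← one_smul k x, ← inv_mul_cancel₀ (two_ne_zero' k), mul_smul, h2, smul_zero]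

section Units

variable {N : Type*} [AddCommGroup N] [Module k N] {E : Idx n m → Idx n m → Module.End k N}

/-- `u` has weight `μ` and is killed by the raising matrix units of the Borel subalgebra attached
to `w`. -/
def IsSingular (E : Idx n m → Idx n m → Module.End k N) (w : Fin (n + m) ≃ Idx n m)
    (μ : Idx n m → k) (u : N) : Prop :=
  ∀ i j, w.symm i ≤ w.symm j → E i j u = (if i = j then μ i else 0) • u

theorem IsMatrixUnits.apply_apply (hE : IsMatrixUnits (k := k) E) (i j p q : Idx n m) (u : N) :
    E i j (E p q u) = sgn k (par i + par j) (par p + par q) • E p q (E i j u) +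
      ((if j = p then E i q u else 0) -
        sgn k (par i + par j) (par p + par q) • (if q = i then E p j u else 0)) := by
  have := LinearMap.congr_fun (hE i j p q) u
  rw [Module.End.mul_apply] at this
  rw [this]
  simp only [LinearMap.add_apply, LinearMap.sub_apply, LinearMap.smul_apply, Module.End.mul_apply]
  congr 2
  · split_ifs <;> simp
  · split_ifs <;> simp

theorem par_add_of_ne {i j : Idx n m} (h : par i ≠ par j) : par i + par j = 1 := by
  rcases zmod_two_cases (par i + par j) with h' | h'
  · exact absurd ((par_add_eq_zero_iff i j).1 h') h
  · exact h'

theorem lt_of_swapAt_le {w : Fin (n + m) ≃ Idx n m} {s t : Fin (n + m)} (hst : (s : ℕ) + 1 = t)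
    {a b : Idx n m} (hab : a ≠ b) (hne : ¬ (a = w t ∧ b = w s))
    (h : (swapAt w s t).symm a ≤ (swapAt w s t).symm b) :
    w.symm a < w.symm b ∧ ¬ (a = w s ∧ b = w t) := by
  obtain ⟨a, rfl⟩ := w.surjective a
  obtain ⟨b, rfl⟩ := w.surjective b
  rw [swapAt_symm_apply, swapAt_symm_apply] at h
  simp only [EmbeddingLike.apply_eq_iff_eq, Equiv.symm_apply_apply] at *
  have hlt := lt_of_le_of_ne h fun e =>
    hab (congrArg w ((Equiv.swap s t).injective e))
  have h2 : ¬ (a = s ∧ b = t) := by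
    rintro ⟨rfl, rfl⟩
    rw [Equiv.swap_apply_left, Equiv.swap_apply_right, Fin.lt_def] at hlt
    omega
  exact ⟨(swap_lt_swap_iff hst h2 hne).1 hlt, h2⟩

theorem lt_left_of_lt_right {w : Fin (n + m) ≃ Idx n m} {s t : Fin (n + m)}
    (hst : (s : ℕ) + 1 = t) {a : Idx n m} (h : w.symm a < w.symm (w t)) (hne : a ≠ w s) :
    w.symm a < w.symm (w s) := by
  obtain ⟨a, rfl⟩ := w.surjective a
  simp only [EmbeddingLike.apply_eq_iff_eq, Equiv.symm_apply_apply, ne_eq, Fin.ext_iff,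
    Fin.lt_def] at *
  omega

theorem lt_right_of_lt_left {w : Fin (n + m) ≃ Idx n m} {s t : Fin (n + m)}
    (hst : (s : ℕ) + 1 = t) {a : Idx n m} (h : w.symm (w s) < w.symm a) (hne : a ≠ w t) :
    w.symm (w t) < w.symm a := by
  obtain ⟨a, rfl⟩ := w.surjective a
  simp only [EmbeddingLike.apply_eq_iff_eq, Equiv.symm_apply_apply, ne_eq, Fin.ext_iff,
    Fin.lt_def] at *
  omega

theorem IsSingular.eq_zero {w : Fin (n + m) ≃ Idx n m} {μ : Idx n m → k} {u : N}
    (hu : IsSingular E w μ u) {i j : Idx n m} (h : w.symm i < w.symm j) : E i j u = 0 := by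
  rw [hu i j h.le, if_neg, zero_smul]
  rintro rfl
  exact lt_irrefl _ h

/-- Every raising unit of the swapped order except $E_{ts}$ was already raising, and since $s,t$ are
adjacent its bracket with $E_{ts}$ is a combination of units that kill $u$. The exception is covered
by $E_{ts}^2=-E_{ts}^2$. -/
theorem IsSingular.reflect [CharZero k] (hE : IsMatrixUnits (k := k) E)
    {w : Fin (n + m) ≃ Idx n m}
    {μ : Idx n m → k} {u : N} (hu : IsSingular E w μ u) {s t : Fin (n + m)}
    (hst : (s : ℕ) + 1 = t) (hp : par (w s) ≠ par (w t)) :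
    IsSingular E (swapAt w s t) (fun i => μ i - (((eps (w s) - eps (w t)) i : ℤ) : k))
      (E (w t) (w s) u) := by
  have hne : w s ≠ w t := fun e => hp (congrArg _ e)
  intro a b hab
  rw [hE.apply_apply]
  by_cases h : a = b
  · subst h
    rw [par_add_self, sgn_zero_left, one_smul, one_smul, hu a a le_rfl, if_pos rfl, if_pos rfl,
      map_smul]
    simp only [Pi.sub_apply, eps, Pi.single_apply]
    by_cases h1 : a = w t
    · subst h1
      simp [hne, hne.symm, add_smul]
    · by_cases h2 : a = w s
      · subst h2
        simp [hne, sub_eq_add_neg, add_smul]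
      · simp [h1, h2, Ne.symm h2]
  rw [if_neg h, zero_smul]
  by_cases h' : a = w t ∧ b = w s
  · obtain ⟨rfl, rfl⟩ := h'
    have := hE.apply_apply (w t) (w s) (w t) (w s) u
    rw [par_add_of_ne hp.symm, sgn_one_one, if_neg hne, smul_zero, sub_zero, add_zero,
      neg_smul, one_smul] at this ⊢
    rw [eq_zero_of_eq_neg_one_smul (this.trans (neg_one_smul k _).symm), neg_zero]
  · obtain ⟨hlt, h''⟩ := lt_of_swapAt_le hst h h' hab
    have e1 : (if b = w t then E a (w s) u else 0) = 0 := by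
      split_ifs with hb
      · subst hb
        exact hu.eq_zero (lt_left_of_lt_right hst hlt fun e => h'' ⟨e, rfl⟩)
      · rfl
    have e2 : (if w s = a then E (w t) b u else 0) = 0 := by
      split_ifs with ha
      · subst ha
        exact hu.eq_zero (lt_right_of_lt_left hst hlt fun e => h'' ⟨rfl, e⟩)
      · rfl
    rw [e1, e2, hu.eq_zero hlt, map_zero, smul_zero, sub_zero, zero_add]

/-- The one raising unit not covered by `IsSingular.reflect` is $E_{st}$, and
$E_{st}E_{ts}u=(\mu_s+\mu_t)u$, which `hμ` makes zero. -/
theorem IsSingular.of_reflect [CharZero k] (hE : IsMatrixUnits (k := k) E)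
    {w : Fin (n + m) ≃ Idx n m}
    {μ : Idx n m → k} {u : N} (hu : IsSingular E w μ u) {s t : Fin (n + m)}
    (hst : (s : ℕ) + 1 = t) (hp : par (w s) ≠ par (w t)) (hμ : μ (w s) + μ (w t) = 0) :
    IsSingular E w (fun i => μ i - (((eps (w s) - eps (w t)) i : ℤ) : k)) (E (w t) (w s) u) := by
  have hne : w s ≠ w t := fun e => hp (congrArg _ e)
  have hlt : w.symm (w s) < w.symm (w t) := by
    rw [Equiv.symm_apply_apply, Equiv.symm_apply_apply, Fin.lt_def]
    omega
  intro a b hab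
  by_cases h : a = w s ∧ b = w t
  · obtain ⟨rfl, rfl⟩ := h
    rw [hE.apply_apply, par_add_of_ne hp, par_add_of_ne hp.symm, sgn_one_one, if_pos rfl,
      if_pos rfl, if_neg hne, hu.eq_zero hlt, hu _ _ le_rfl, hu _ _ le_rfl, if_pos rfl, if_pos rfl,
      map_zero, smul_zero, zero_add, neg_smul, one_smul, sub_neg_eq_add, ← add_smul, hμ, zero_smul,
      zero_smul]
  · refine hu.reflect hE hst hp a b ?_
    by_cases hab' : a = b
    · rw [hab']
    obtain ⟨a, rfl⟩ := w.surjective a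
    obtain ⟨b, rfl⟩ := w.surjective b
    simp only [EmbeddingLike.apply_eq_iff_eq, Equiv.symm_apply_apply, swapAt_symm_apply] at *
    refine ((swap_lt_swap_iff hst h ?_).2 (lt_of_le_of_ne hab hab')).le
    rintro ⟨rfl, rfl⟩
    rw [Fin.le_def] at hab
    omega

/-- The submodule generated by a singular vector is generated by lowering units alone, so its
weights do not exceed $\nu$, whereas $u_0$ has a strictly higher weight. -/
theorem exists_stable_submodule [CharZero k] (hE : IsMatrixUnits (k := k) E)
    {w : Fin (n + m) ≃ Idx n m} {ν : Idx n m → k} {u₀ u₁ : N} (hu : IsSingular E w ν u₁)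
    {s t : Fin (n + m)} (hst : s < t) (h0 : u₀ ≠ 0)
    (hw : ∀ i, E i i u₀ = (ν i + (((eps (w s) - eps (w t)) i : ℤ) : k)) • u₀) :
    ∃ Q : Submodule k N, u₁ ∈ Q ∧ (∀ i j, ∀ y ∈ Q, E i j y ∈ Q) ∧ u₀ ∉ Q := by
  let stable : Set (Submodule k N) :=
    {T | u₁ ∈ T ∧ ∀ i j, w.symm i < w.symm j → ∀ y ∈ T, E j i y ∈ T}
  let Q := sInf stable
  have hQ : Q ∈ stable := by
    refine ⟨Submodule.mem_sInf.2 fun T hT => hT.1, fun i j hij y hy => ?_⟩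
    exact Submodule.mem_sInf.2 fun T hT => hT.2 i j hij y (Submodule.mem_sInf.1 hy T hT)
  refine ⟨Q, hQ.1, ?_, ?_⟩
  · let T : Submodule k N :=
      { carrier := {y | y ∈ Q ∧ ∀ i j, E i j y ∈ Q}
        add_mem' := fun ha hb => ⟨Q.add_mem ha.1 hb.1, fun i j => by
          rw [map_add]; exact Q.add_mem (ha.2 i j) (hb.2 i j)⟩
        zero_mem' := ⟨Q.zero_mem, fun i j => by rw [map_zero]; exact Q.zero_mem⟩
        smul_mem' := fun c y hy => ⟨Q.smul_mem c hy.1, fun i j => by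
          rw [map_smul]; exact Q.smul_mem c (hy.2 i j)⟩ }
    have hT : T ∈ stable := by
      refine ⟨⟨hQ.1, fun i j => ?_⟩, fun i j hij y hy => ⟨hQ.2 i j hij y hy.1, fun a b => ?_⟩⟩
      · rcases le_or_gt (w.symm i) (w.symm j) with h | h
        · rw [hu i j h]
          exact Q.smul_mem _ hQ.1
        · exact hQ.2 j i h _ hQ.1
      · rw [hE.apply_apply]
        refine Q.add_mem (Q.smul_mem _ (hQ.2 i j hij _ (hy.2 a b)))
          (Q.sub_mem ?_ (Q.smul_mem _ ?_))
        · split_ifs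
          · exact hy.2 _ _
          · exact Q.zero_mem
        · split_ifs
          · exact hy.2 _ _
          · exact Q.zero_mem
    intro i j y hy
    exact ((sInf_le hT : Q ≤ T) hy).2 i j
  · let d : Idx n m → k := fun i => -((w.symm i : ℕ) : k)
    let H : Module.End k N := ∑ i, d i • E i i
    have hH : ∀ y, H y = ∑ i, d i • E i i y := fun y => by
      simp [H, LinearMap.sum_apply]
    let e : k := ∑ i, d i * ν i
    let T : Submodule k N := ⨆ c : ℕ, H.eigenspace (e - c)
    have hcomm : ∀ i j y, H (E j i y) = E j i (H y) + (d j - d i) • E j i y := by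
      intro i j y
      have term : ∀ a, d a • E a a (E j i y) = d a • E j i (E a a y) +
          (d a • (if a = j then E a i y else 0) - d a • (if i = a then E j a y else 0)) := by
        intro a
        rw [hE.apply_apply, par_add_self, sgn_zero_left, one_smul, one_smul, smul_add, smul_sub]
      rw [hH, hH, map_sum, Finset.sum_congr rfl fun a _ => term a]
      simp only [Finset.sum_add_distrib, Finset.sum_sub_distrib, map_smul, sub_smul]
      congr 2
      · rw [Finset.sum_eq_single j]
        · rw [if_pos rfl]
        · intro b _ hb
          rw [if_neg hb, smul_zero]
        · simp
      · rw [Finset.sum_eq_single i]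
        · rw [if_pos rfl]
        · intro b _ hb
          rw [if_neg hb.symm, smul_zero]
        · simp
    have hT : T ∈ stable := by
      constructor
      · refine (le_iSup (fun c : ℕ => H.eigenspace (e - c)) 0) ?_
        rw [Module.End.mem_eigenspace_iff, hH, Nat.cast_zero, sub_zero, Finset.sum_smul]
        refine Finset.sum_congr rfl fun i _ => ?_
        rw [hu i i le_rfl, if_pos rfl, smul_smul]
      · intro i j hij y hy
        induction hy using Submodule.iSup_induction' with
        | zero => rw [map_zero]; exact T.zero_mem
        | add x y _ _ hx hy => rw [map_add]; exact T.add_mem hx hy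
        | mem c y hy =>
          refine (le_iSup (fun c : ℕ => H.eigenspace (e - c))
            (c + ((w.symm j : ℕ) - (w.symm i : ℕ)))) ?_
          rw [Module.End.mem_eigenspace_iff] at hy ⊢
          rw [hcomm, hy, map_smul, ← add_smul]
          congr 1
          rw [Fin.lt_def] at hij
          push_cast [Nat.cast_sub hij.le]
          ring
    intro hu₀
    have h1 : u₀ ∈ T := (sInf_le hT : Q ≤ T) hu₀
    let e₀ : k := e + ((t : ℕ) - (s : ℕ) : k)
    have h2 : u₀ ∈ H.eigenspace e₀ := by
      rw [Module.End.mem_eigenspace_iff, hH]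
      simp only [hw, smul_smul, mul_add, ← Finset.sum_smul, Finset.sum_add_distrib]
      congr 2
      simp [eps, Pi.single_apply, mul_sub, Finset.sum_sub_distrib, d]
      ring
    -- The eigenvalue of $u_0$ is $e+(t-s)$, which in characteristic zero differs from every $e-c$
    -- with $c\ge 0$; eigenspaces are independent.
    have h3 : T ≤ ⨆ μ, ⨆ (_ : μ ≠ e₀), H.eigenspace μ := by
      refine iSup_le fun c => le_iSup₂_of_le (e - c) ?_ le_rfl
      intro h
      have h4 : ((s : ℕ) : k) = ((t + c : ℕ) : k) := by
        push_cast
        linear_combination h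
      have h5 := Nat.cast_injective h4
      rw [Fin.lt_def] at hst
      omega
    exact h0 (Submodule.disjoint_def.1 (H.eigenspaces_iSupIndep e₀) u₀ h2 (h3 h1))

theorem envLift_mem (g : LieSubsuperalgebra k n m) (hE : IsMatrixUnits (k := k) E)
    {Q : Submodule k N} (hQ : ∀ i j, ∀ y ∈ Q, E i j y ∈ Q) (a : Env g) :
    ∀ y ∈ Q, envLift g hE a y ∈ Q := by
  obtain ⟨a, rfl⟩ := RingQuot.mkAlgHom_surjective k (EnvRel g) a
  induction a using TensorAlgebra.induction with
  | algebraMap r =>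
    intro y hy
    rw [AlgHom.commutes, AlgHom.commutes, Module.algebraMap_end_apply]
    exact Q.smul_mem _ hy
  | ι x =>
    intro y hy
    have := envLift_toEnv g hE x
    rw [toEnv] at this
    rw [this, ofUnits_apply]
    simp only [LinearMap.sum_apply, LinearMap.smul_apply]
    exact Q.sum_mem fun i _ => Q.sum_mem fun j _ => Q.smul_mem _ (hQ i j y hy)
  | mul a b ha hb =>
    intro y hy
    rw [map_mul, map_mul, Module.End.mul_apply]
    exact ha _ (hb y hy)
  | add a b ha hb =>
    intro y hy
    rw [map_add, map_add, LinearMap.add_apply]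
    exact Q.add_mem (ha y hy) (hb y hy)

end Units

/-! ### Highest weight vectors in modules over the enveloping algebra -/

section Env

variable {g : LieSubsuperalgebra k n m}

theorem toEnv_add (x y : g.toSubmodule) : toEnv g (x + y) = toEnv g x + toEnv g y := by
  simp [toEnv]

theorem toEnv_smul (c : k) (x : g.toSubmodule) : toEnv g (c • x) = c • toEnv g x := by
  simp [toEnv]

theorem toEnv_zero : toEnv g 0 = 0 := by
  simp [toEnv]

theorem toEnv_mul_toEnv {p q : ZMod 2} {x y : g.toSubmodule} (hx : IsHomog p x.1)
    (hy : IsHomog q y.1) : toEnv g x * toEnv g y = sgn k p q • (toEnv g y * toEnv g x) +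
      toEnv g ⟨superBracket x.1 y.1, g.bracket_mem x.1 y.1 x.2 y.2⟩ := by
  have := RingQuot.mkAlgHom_rel k (EnvRel.mk p q x y hx hy)
  simpa [toEnv] using this

theorem evalWt_add (μ : Idx n m → k) (x y : Mat k n m) :
    evalWt μ (x + y) = evalWt μ x + evalWt μ y := by
  simp [evalWt, mul_add, Finset.sum_add_distrib]

theorem evalWt_smul (μ : Idx n m → k) (c : k) (x : Mat k n m) :
    evalWt μ (c • x) = c * evalWt μ x := by
  simp only [evalWt, Finset.mul_sum, Matrix.smul_apply, smul_eq_mul]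
  exact Finset.sum_congr rfl fun _ _ => by ring

/-- The diagonal part is kept as a single element because $\mathfrak{sl}(n|m)$ does not contain the
diagonal matrix units. It lies in $\mathfrak g$ since all the off-diagonal units do. -/
theorem borel_induction (hg : ∀ i j : Idx n m, i ≠ j → Matrix.single i j 1 ∈ g.toSubmodule)
    {w : Fin (n + m) ≃ Idx n m} {P : g.toSubmodule → Prop}
    (add : ∀ x y, P x → P y → P (x + y))
    (smul : ∀ (c : k) x, P x → P (c • x))
    (diagonal : ∀ d (h : Matrix.diagonal d ∈ g.toSubmodule), P ⟨Matrix.diagonal d, h⟩)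
    (single : ∀ i j (hij : i ≠ j), w.symm i < w.symm j → P ⟨Matrix.single i j 1, hg i j hij⟩)
    (x : g.toSubmodule) (hx : x.1 ∈ (borel g w).toSubmodule) : P x := by
  have zero : P 0 := by
    have := smul 0 _ (diagonal (fun _ => 0) (by rw [Matrix.diagonal_zero]; exact g.toSubmodule.zero_mem))
    rwa [zero_smul] at this
  let z : Idx n m → Idx n m → g.toSubmodule := fun i j =>
    if h : i ≠ j then x.1 i j • ⟨Matrix.single i j 1, hg i j h⟩ else 0
  have hz : ∀ i j, P (z i j) := by
    intro i j
    by_cases h : i ≠ j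
    · simp only [z, dif_pos h]
      rcases lt_or_gt_of_ne fun e => h (w.symm.injective e) with h' | h'
      · exact smul _ _ (single i j h h')
      · rw [hx.2 i j h', zero_smul]
        exact zero
    · simp only [z, dif_neg h]
      exact zero
  have hzv : ∀ i j a b, (z i j).1 a b = if i ≠ j ∧ i = a ∧ j = b then x.1 a b else 0 := by
    intro i j a b
    by_cases h : i ≠ j
    · simp only [z, dif_pos h]
      change (x.1 i j • Matrix.single i j (1 : k)) a b = _
      rw [Matrix.smul_apply, smul_eq_mul]
      by_cases hab : i = a ∧ j = b
      · rw [if_pos ⟨h, hab⟩]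
        obtain ⟨rfl, rfl⟩ := hab
        rw [Matrix.single_apply_same, mul_one]
      · rw [if_neg fun e => hab e.2, Matrix.single_apply_of_ne _ _ _ _ _ hab, mul_zero]
    · simp only [z, dif_neg h]
      rw [if_neg fun e => h e.1]
      rfl
  have hsum : P (∑ i, ∑ j, z i j) :=
    Finset.sum_induction _ P add zero fun i _ => Finset.sum_induction _ P add zero fun j _ => hz i j
  have hd : (x - ∑ i, ∑ j, z i j : g.toSubmodule).1 = Matrix.diagonal fun i => x.1 i i := by
    ext a b
    rw [Submodule.coe_sub, Matrix.sub_apply]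
    simp only [Submodule.coe_sum, Matrix.sum_apply, hzv]
    rw [Finset.sum_eq_single a, Finset.sum_eq_single b]
    · by_cases hab : a = b
      · subst hab; simp
      · simp [hab]
    · intro c _ hc
      rw [if_neg fun e => hc e.2.2]
    · simp
    · intro c _ hc
      exact Finset.sum_eq_zero fun e _ => if_neg fun h => hc h.2.1
    · simp
  have hmem := (x - ∑ i, ∑ j, z i j : g.toSubmodule).2
  rw [hd] at hmem
  have hdiag : P (x - ∑ i, ∑ j, z i j) := by
    have h := diagonal _ hmem
    have e : x - ∑ i, ∑ j, z i j = ⟨_, hmem⟩ := Subtype.ext hd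
    rw [e]
    exact h
  have := add _ _ hdiag hsum
  rwa [sub_add_cancel] at this

variable {M : Type*} [AddCommGroup M] [Module k M] [Module (Env g) M]

/-- The Borel subalgebra attached to `w` acts on `v` through the weight `μ`. -/
def HasBorelWeight (g : LieSubsuperalgebra k n m) [Module (Env g) M] (w : Fin (n + m) ≃ Idx n m)
    (μ : Idx n m → k) (v : M) : Prop :=
  ∀ x : g.toSubmodule, x.1 ∈ (borel g w).toSubmodule → toEnv g x • v = evalWt μ x.1 • v

theorem HasBorelWeight.eq_zero {w : Fin (n + m) ≃ Idx n m} {μ : Idx n m → k} {v : M}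
    (hv : HasBorelWeight g w μ v) (x : g.toSubmodule)
    (hx : ∀ a b, w.symm b ≤ w.symm a → x.1 a b = 0) : toEnv g x • v = 0 := by
  rw [hv x ⟨x.2, fun i j h => hx i j h.le⟩, evalWt, Finset.sum_eq_zero, zero_smul]
  intro i _
  rw [hx i i le_rfl, mul_zero]

/-- The argument of `IsSingular.reflect`, carried out inside $U(\mathfrak g)$ because the Verma
module need not carry an action of all matrix units. -/
theorem HasBorelWeight.reflect [CharZero k] [IsScalarTower k (Env g) M]
    (hg : ∀ i j : Idx n m, i ≠ j → Matrix.single i j 1 ∈ g.toSubmodule)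
    {w : Fin (n + m) ≃ Idx n m} {μ : Idx n m → k} {v : M} (hv : HasBorelWeight g w μ v)
    {s t : Fin (n + m)} (hst : (s : ℕ) + 1 = t) (hp : par (w s) ≠ par (w t))
    {f : g.toSubmodule} {c : k} (hf : f.1 = Matrix.single (w t) (w s) c) :
    HasBorelWeight g (swapAt w s t) (fun i => μ i - (((eps (w s) - eps (w t)) i : ℤ) : k))
      (toEnv g f • v) := by
  have hne : w s ≠ w t := fun e => hp (congrArg _ e)
  have hfh : IsHomog 1 f.1 := by
    rw [hf, ← par_add_of_ne hp.symm]
    exact isHomog_single _ _ _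
  refine borel_induction hg ?_ ?_ ?_ ?_
  · intro x y hx hy
    rw [toEnv_add, add_smul, hx, hy, Submodule.coe_add, evalWt_add, add_smul]
  · intro c x hx
    rw [toEnv_smul, smul_assoc, hx, Submodule.coe_smul, evalWt_smul, mul_smul]
  · intro d hd
    have hdw : Matrix.diagonal d ∈ (borel g w).toSubmodule := by
      refine ⟨hd, fun i j hij => Matrix.diagonal_apply_ne _ ?_⟩
      rintro rfl
      exact lt_irrefl _ hij
    have hbr : (⟨superBracket (Matrix.diagonal d) f.1, g.bracket_mem _ _ hd f.2⟩ :
        g.toSubmodule) = (d (w t) - d (w s)) • f := by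
      refine Subtype.ext ?_
      change superBracket (Matrix.diagonal d) f.1 = (d (w t) - d (w s)) • f.1
      rw [superBracket_diagonal, hf]
      ext a b
      simp only [Matrix.sub_apply, Matrix.diagonal_mul, Matrix.mul_diagonal, Matrix.smul_apply,
        smul_eq_mul]
      by_cases hab : w t = a ∧ w s = b
      · obtain ⟨rfl, rfl⟩ := hab
        rw [Matrix.single_apply_same]; ring
      · simp [Matrix.single_apply_of_ne _ _ _ _ _ hab]
    have := toEnv_mul_toEnv (g := g) (x := ⟨Matrix.diagonal d, hd⟩) (isHomog_diagonal d) hfh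
    rw [hbr, toEnv_smul, sgn_zero_left, one_smul] at this
    rw [← mul_smul, this, add_smul, mul_smul, hv _ hdw, smul_assoc, smul_comm (toEnv g f),
      ← add_smul]
    congr 1
    simp [evalWt, eps, Pi.single_apply, sub_mul, Finset.sum_sub_distrib]
    ring
  · intro i j hij hlt
    have hev : evalWt (fun i => μ i - (((eps (w s) - eps (w t)) i : ℤ) : k))
        (Matrix.single i j 1) = 0 := by
      refine Finset.sum_eq_zero fun a _ => ?_
      rw [Matrix.single_apply_of_ne, mul_zero]
      rintro ⟨rfl, rfl⟩
      exact hij rfl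
    rw [hev, zero_smul, ← mul_smul]
    by_cases h' : i = w t ∧ j = w s
    · obtain ⟨rfl, rfl⟩ := h'
      have hff : toEnv g f * toEnv g f = 0 := by
        have := toEnv_mul_toEnv hfh hfh
        have hbr : (⟨superBracket f.1 f.1, g.bracket_mem _ _ f.2 f.2⟩ : g.toSubmodule) = 0 := by
          refine Subtype.ext ?_
          change superBracket f.1 f.1 = 0
          rw [superBracket_of_isHomog hfh hfh, hf, Matrix.single_mul_single_of_ne _ _ _ _ hne,
            smul_zero, sub_zero]
        rw [hbr, toEnv_zero, add_zero, sgn_one_one] at this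
        exact eq_zero_of_eq_neg_one_smul this
      have hfe : f.1 = c • Matrix.single (w t) (w s) 1 := by
        rw [hf, Matrix.smul_single, smul_eq_mul, mul_one]
      by_cases hc : c = 0
      · have : f = 0 := Subtype.ext (by rw [hfe, hc, zero_smul]; rfl)
        rw [this, toEnv_zero, mul_zero, zero_smul]
      · have : (⟨Matrix.single (w t) (w s) 1, hg _ _ hij⟩ : g.toSubmodule) = c⁻¹ • f := by
          refine Subtype.ext ?_
          change _ = c⁻¹ • f.1
          rw [hfe, inv_smul_smul₀ hc]
        rw [this, toEnv_smul, smul_mul_assoc, hff, smul_zero, zero_smul]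
    obtain ⟨hlt', h''⟩ := lt_of_swapAt_le hst hij h' hlt.le
    have hsi := isHomog_single i j (1 : k)
    rw [toEnv_mul_toEnv (g := g) (x := ⟨Matrix.single i j 1, hg i j hij⟩) hsi hfh, add_smul,
      smul_assoc, mul_smul, hv.eq_zero, hv.eq_zero, smul_zero, smul_zero, add_zero]
    · intro a b hab
      change superBracket (Matrix.single i j 1) f.1 a b = 0
      rw [superBracket_of_isHomog hsi hfh, hf, Matrix.sub_apply, Matrix.smul_apply]
      have e1 : (Matrix.single i j 1 * Matrix.single (w t) (w s) c : Mat k n m) a b = 0 := by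
        by_cases hj : j = w t
        · subst hj
          rw [Matrix.single_mul_single_same, Matrix.single_apply_of_ne]
          rintro ⟨rfl, rfl⟩
          exact (lt_left_of_lt_right hst hlt' fun e => h'' ⟨e, rfl⟩).not_ge hab
        · rw [Matrix.single_mul_single_of_ne _ _ _ _ hj]
          rfl
      have e2 : (Matrix.single (w t) (w s) c * Matrix.single i j 1 : Mat k n m) a b = 0 := by
        by_cases hj : w s = i
        · subst hj
          rw [Matrix.single_mul_single_same, Matrix.single_apply_of_ne]
          rintro ⟨rfl, rfl⟩
          exact (lt_right_of_lt_left hst hlt' fun e => h'' ⟨rfl, e⟩).not_ge hab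
        · rw [Matrix.single_mul_single_of_ne _ _ _ _ hj]
          rfl
      rw [e1, e2, smul_zero, sub_zero]
    · intro a b hab
      change Matrix.single i j (1 : k) a b = 0
      rw [Matrix.single_apply_of_ne]
      rintro ⟨rfl, rfl⟩
      exact hlt'.not_ge hab

end Env

/-! ### Chains of odd reflections in the Verma module of highest weight `-ρ` -/

theorem IsSingular.ofUnits_apply {N : Type*} [AddCommGroup N] [Module k N]
    {E : Idx n m → Idx n m → Module.End k N} {w : Fin (n + m) ≃ Idx n m} {μ : Idx n m → k} {u : N}
    (hu : IsSingular E w μ u) {x : Mat k n m} (hx : ∀ i j, w.symm j < w.symm i → x i j = 0) :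
    ofUnits (k := k) E x u = evalWt μ x • u := by
  rw [SuperGL.ofUnits_apply, LinearMap.sum_apply, evalWt, Finset.sum_smul]
  refine Finset.sum_congr rfl fun i _ => ?_
  rw [LinearMap.sum_apply, Finset.sum_eq_single i]
  · rw [LinearMap.smul_apply, hu i i le_rfl, if_pos rfl, smul_smul, mul_comm]
  · intro j _ hj
    rw [LinearMap.smul_apply]
    rcases lt_or_ge (w.symm j) (w.symm i) with h | h
    · rw [hx i j h, zero_smul]
    · rw [hu i j h, if_neg hj.symm, zero_smul, smul_zero]
  · simp

/-- The multiple of the supertrace by which the Fock space is twisted. -/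
def fockTwist (k : Type*) [Field k] (n m : ℕ) : k := ((n : k) - m - 1) / 2

/-- The vector is the product of inverse minors tensored with the product of all odd variables in
even rows; it is the image of $v_\lambda$. -/
theorem exists_fock_vector [CharZero k] : ∃ u : Fock k n m,
    IsSingular (fockUnits (fockTwist k n m)) (dist n m) (-rho k (dist n m)) u ∧
      fockEval u ≠ 0 ∧ ∀ a c, par a = 0 → par c = 1 → fermi a c (fockEval u) = 0 := by
  classical
  obtain ⟨f, hf1, hf⟩ := exists_isHighestWeightFun (k := k) (n := n) (m := m)
  obtain ⟨w, hw0, hwk, hw1, hw2⟩ := exists_fermi_vacuum (k := k)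
    (Finset.univ.filter fun p : Idx n m × Idx n m => par p.1 = 0 ∧ par p.2 = 1)
    fun p hp => (Finset.mem_filter.1 hp).2.1
  have h1 : ∀ a l, par a = 0 → par l = 1 → fermi a l w = 0 := fun a l ha hl =>
    hw1 (a, l) (Finset.mem_filter.2 ⟨Finset.mem_univ _, ha, hl⟩)
  have h2 : ∀ a l, par a = 1 → par l = 0 → fermiD a l w = 0 := fun a l ha _ =>
    hw2 (a, l) fun h => zero_ne_one ((Finset.mem_filter.1 h).2.1.symm.trans ha)
  have he : fockEval (f ⊗ₜ[k] w) = w := by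
    rw [fockEval_tmul, hf1, one_smul, hwk]
  refine ⟨f ⊗ₜ[k] w, fun i j hij => ?_, by rwa [he], fun a c ha hc => by rw [he]; exact h1 a c ha hc⟩
  rw [fockUnits_tmul_of_le _ hf h1 h2 hij]
  congr 1
  by_cases h : i = j
  · rw [if_pos h, if_pos h]
    exact neg_rho_dist (k := k) i
  · rw [if_neg h, if_neg h]

/-- The properties of the vectors in a chain of odd reflections: `v` has weight `-ρ` for the Borel
subalgebra attached to `w`, and the corresponding vector `u` of the Fock space with vacuum `u₀` has
nonzero image under the evaluation. -/
structure IsChainVector (g : LieSubsuperalgebra k n m) (lam : Idx n m → k)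
    (u₀ : Fock k n m) (w : Fin (n + m) ≃ Idx n m) (v : Verma g (dist n m) lam)
    (u : Fock k n m) : Prop where
  exists_rep : ∃ a : Env g, v = Submodule.Quotient.mk a ∧
    envLift g (isMatrixUnits_fock (fockTwist k n m)) a u₀ = u
  hasBorelWeight : HasBorelWeight g w (-rho k w) v
  isSingular : IsSingular (fockUnits (fockTwist k n m)) w (-rho k w) u
  eval_ne_zero : fockEval u ≠ 0
  fermi_eval : ∀ a c, par a = 0 → par c = 1 → w.symm a < w.symm c → fermi a c (fockEval u) = 0

/-- This is the well-definedness of the map from the Verma module to the Fock space that sends the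
highest weight vector to $u_0$. -/
theorem envLift_apply_eq_zero {g : LieSubsuperalgebra k n m} {lam : Idx n m → k} {t : k}
    {u₀ : Fock k n m} (hu : IsSingular (fockUnits t) (dist n m) lam u₀) {a : Env g}
    (ha : (Submodule.Quotient.mk a : Verma g (dist n m) lam) = 0) :
    envLift g (isMatrixUnits_fock t) a u₀ = 0 := by
  rw [Submodule.Quotient.mk_eq_zero] at ha
  induction ha using Submodule.span_induction with
  | mem a ha =>
    obtain ⟨x, hx, rfl⟩ := ha
    rw [map_sub, envLift_toEnv, AlgHom.commutes, LinearMap.sub_apply, Module.algebraMap_end_apply,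
      hu.ofUnits_apply hx.2, sub_self]
  | zero => rw [map_zero, LinearMap.zero_apply]
  | add a b _ _ ha hb => rw [map_add, LinearMap.add_apply, ha, hb, add_zero]
  | smul c a _ ha => rw [smul_eq_mul, map_mul, Module.End.mul_apply, ha, map_zero]

theorem neg_rho_swapAt [CharZero k] (w : Fin (n + m) ≃ Idx n m) {s t : Fin (n + m)}
    (hst : (s : ℕ) + 1 = t) (hp : par (w s) ≠ par (w t)) :
    (fun i => (-rho k w) i - (((eps (w s) - eps (w t)) i : ℤ) : k)) = -rho k (swapAt w s t) := by
  ext i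
  rw [Pi.neg_apply, Pi.neg_apply, rho_swapAt w hst hp]
  ring

theorem IsChainVector.reflect [CharZero k] {g : LieSubsuperalgebra k n m} {lam : Idx n m → k}
    (hg : ∀ i j : Idx n m, i ≠ j → Matrix.single i j 1 ∈ g.toSubmodule)
    {u₀ u : Fock k n m} {w : Fin (n + m) ≃ Idx n m} {v : Verma g (dist n m) lam}
    (hu₀ : IsSingular (fockUnits (fockTwist k n m)) (dist n m) lam u₀)
    (h : IsChainVector g lam u₀ w v u) {s t : Fin (n + m)} (hst : (s : ℕ) + 1 = t)
    (hs : par (w s) = 0) (ht : par (w t) = 1) {x : g.toSubmodule}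
    (hx : (x : Mat k n m) ∈ rootSpace g (-(eps (w s) - eps (w t)))) (hx0 : x ≠ 0) :
    (∃ u', IsChainVector g lam u₀ (swapAt w s t) (toEnv g x • v) u') ∧
      v ∉ Submodule.span (Env g) {toEnv g x • v} := by
  have hE := isMatrixUnits_fock (n := n) (m := m) (fockTwist k n m)
  have hp : par (w s) ≠ par (w t) := by rw [hs, ht]; exact zero_ne_one
  have hne : w s ≠ w t := fun e => hp (congrArg _ e)
  have hlt : s < t := by rw [Fin.lt_def]; omega
  rw [neg_sub] at hx
  have hxe := exists_smul_single_of_mem_rootSpace hne.symm hx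
  set c := x.1 (w t) (w s) with hc
  have hc0 : c ≠ 0 := by
    intro h0
    refine hx0 (Subtype.ext ?_)
    rw [hxe, h0, zero_smul]
    rfl
  obtain ⟨a, rfl, rfl⟩ := h.exists_rep
  set u := envLift g hE a u₀ with hu
  set E := fockUnits (n := n) (m := m) (fockTwist k n m) with hEdef
  have hxu : envLift g hE (toEnv g x * a) u₀ = c • E (w t) (w s) u := by
    rw [map_mul, Module.End.mul_apply, envLift_toEnv, hxe, map_smul, ofUnits_single, one_smul,
      LinearMap.smul_apply]
  have heval : fockEval (c • E (w t) (w s) u) = c • fermiD (w s) (w t) (fockEval u) := by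
    rw [map_smul, fockEval_fockUnits _ ht hs]
  have hvac : fermi (w s) (w t) (fockEval u) = 0 :=
    h.fermi_eval _ _ hs ht (by rwa [Equiv.symm_apply_apply, Equiv.symm_apply_apply])
  -- The variable being removed is still a factor of the evaluation, so multiplying it back recovers
  -- the evaluation and the derivative is nonzero.
  have hD : fermi (w s) (w t) (fermiD (w s) (w t) (fockEval u)) = fockEval u := by
    have := fermiD_fermi (w s) (w t) (w s) (w t) (fockEval u)
    rw [hvac, map_zero, if_pos ⟨rfl, rfl⟩, one_smul] at this
    exact neg_add_eq_zero.1 this.symm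
  have hsmul : ∀ {w' : Fin (n + m) ≃ Idx n m} {μ : Idx n m → k} {y : Fock k n m},
      IsSingular E w' μ y → IsSingular E w' μ (c • y) := by
    intro w' μ y hy i j hij
    rw [map_smul, hy i j hij, smul_comm]
  refine ⟨⟨c • E (w t) (w s) u, ⟨⟨toEnv g x * a, rfl, hxu⟩, ?_, ?_, ?_, ?_⟩⟩, ?_⟩
  · rw [← neg_rho_swapAt w hst hp]
    refine h.hasBorelWeight.reflect hg hst hp (c := c) ?_
    rw [hxe, Matrix.smul_single, smul_eq_mul, mul_one]
  · rw [← neg_rho_swapAt w hst hp]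
    exact hsmul (h.isSingular.reflect hE hst hp)
  · rw [heval]
    refine smul_ne_zero hc0 fun h0 => h.eval_ne_zero ?_
    rw [← hD, h0, map_zero]
  -- A pair still in even-before-odd order differs from the one just exchanged, so its variable
  -- anticommutes with the derivative and remains a factor.
  · intro i j hi hj hij
    have hij' : i ≠ j := by rintro rfl; exact lt_irrefl _ hij
    obtain ⟨hlt', hne'⟩ := lt_of_swapAt_le hst hij'
      (fun e => zero_ne_one (hi.symm.trans (e.1 ▸ ht))) hij.le
    have h1 := fermiD_fermi (w s) (w t) i j (fockEval u)
    rw [h.fermi_eval i j hi hj hlt', map_zero, if_neg fun e => hne' ⟨e.1.symm, e.2.symm⟩,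
      zero_smul, add_zero, eq_comm, neg_eq_zero] at h1
    rw [heval, map_smul, h1, smul_zero]
  · intro hmem
    -- A relation $v=y\,x\,v$ would carry over to the Fock space and put $u$ in the submodule
    -- generated by $E_{ts}u$.
    obtain ⟨y, hy⟩ := Submodule.mem_span_singleton.1 hmem
    have hμ : (-rho k w) (w s) + (-rho k w) (w t) = 0 := by
      rw [Pi.neg_apply, Pi.neg_apply, ← neg_add, rho_add_rho_eq_zero w hst hp, neg_zero]
    obtain ⟨Q, hQ1, hQ2, hQ3⟩ := exists_stable_submodule hE
      (h.isSingular.of_reflect hE hst hp hμ) hlt (u₀ := u)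
      (fun h0 => h.eval_ne_zero (by rw [h0, map_zero])) (fun i => by
        rw [h.isSingular i i le_rfl, if_pos rfl, sub_add_cancel])
    have hz : (Submodule.Quotient.mk (y * (toEnv g x * a) - a) : Verma g (dist n m) lam) = 0 := by
      rw [Submodule.Quotient.mk_sub, sub_eq_zero]
      exact hy
    have h0 := envLift_apply_eq_zero hu₀ hz
    rw [map_sub, map_mul, LinearMap.sub_apply, Module.End.mul_apply, sub_eq_zero] at h0
    refine hQ3 ?_
    change envLift g hE a u₀ ∈ Q
    rw [← h0]
    refine envLift_mem g hE hQ2 y _ ?_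
    rw [hxu]
    exact Q.smul_mem c hQ1

/-! ### Induction along a chain. -/

theorem chainWeight_zero (lam : Idx n m → k) {r : ℕ} (β : Fin r → Idx n m → ℤ) :
    chainWeight lam β 0 = lam := by
  ext l
  simp [chainWeight]

theorem chainWeight_succ (lam : Idx n m → k) {r : ℕ} (β : Fin r → Idx n m → ℤ) (i : Fin r) :
    chainWeight lam β i.succ = fun l => chainWeight lam β i.castSucc l - (β i l : k) := by
  ext l
  have : (Finset.univ.filter fun j : Fin r => j.castSucc < i.succ) =
      insert i (Finset.univ.filter fun j : Fin r => j.castSucc < i.castSucc) := by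
    ext j
    simp only [Finset.mem_filter, Finset.mem_univ, true_and, Finset.mem_insert, Fin.lt_def,
      Fin.val_castSucc, Fin.val_succ, Fin.ext_iff]
    omega
  rw [chainWeight, chainWeight, this, Finset.sum_insert (by simp)]
  ring

/-- The Verma module of highest weight `-ρ` is reflection complete, for every subsuperalgebra of
`gl(n|m)` containing the off-diagonal matrix units. -/
theorem reflectionComplete_neg_rho [CharZero k] {g : LieSubsuperalgebra k n m}
    (hg : ∀ i j : Idx n m, i ≠ j → Matrix.single i j 1 ∈ g.toSubmodule) :
    ReflectionComplete g (-rho k (dist n m)) := by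
  intro r b β x v hc
  obtain ⟨u₀, hu₀, he₀, hf₀⟩ := exists_fock_vector (k := k) (n := n) (m := m)
  have step : ∀ i : Fin r, ∀ w u, b i.castSucc = borel g w →
      IsChainVector g (-rho k (dist n m)) u₀ w (v i.castSucc) u →
      ∃ s t : Fin (n + m), (s : ℕ) + 1 = t ∧ par (w s) ≠ par (w t) ∧
        β i = eps (w s) - eps (w t) ∧ b i.succ = borel g (swapAt w s t) ∧
        (∃ u', IsChainVector g (-rho k (dist n m)) u₀ (swapAt w s t) (v i.succ) u') ∧
        v i.castSucc ∉ Submodule.span (Env g) {v i.succ} := by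
    intro i w u hb hv
    have hadj := hc.adjacent i
    have hroot := hc.root_subset i
    rw [hb] at hadj hroot
    obtain ⟨s, t, hst, hs, ht, hβ, hb'⟩ := hadj.exists_swapAt hg (hc.odd i) (hc.positive i) hroot
      (hc.neg_root_subset i)
    have hx := hc.x_mem i
    rw [hβ] at hx
    obtain ⟨h1, h2⟩ := hv.reflect hg hu₀ hst hs ht hx (hc.x_ne i)
    rw [← hc.v_succ i] at h1 h2
    exact ⟨s, t, hst, by rw [hs, ht]; exact zero_ne_one, hβ, hb', h1, h2⟩
  -- The weight of the chain is identified with $-\rho$ of the current ordering, so that the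
  -- vanishing on the next simple root is available at every step.
  have main : ∀ i : Fin (r + 1), ∃ w u, b i = borel g w ∧
      chainWeight (-rho k (dist n m)) β i = -rho k w ∧
      IsChainVector g (-rho k (dist n m)) u₀ w (v i) u := by
    intro i
    induction i using Fin.induction with
    | zero =>
      refine ⟨dist n m, u₀, hc.b_zero, chainWeight_zero _ _, ⟨1, hc.v_zero, ?_⟩, ?_, hu₀, he₀,
        fun a c ha hc' _ => hf₀ a c ha hc'⟩
      · rw [map_one, Module.End.one_apply]
      · intro y hy
        rw [hc.v_zero, ← algebraMap_smul (Env g) (evalWt (-rho k (dist n m)) y.1), ← sub_eq_zero,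
          ← sub_smul]
        refine (Submodule.Quotient.mk_eq_zero _).2 ?_
        change (toEnv g y - algebraMap k (Env g) _) * 1 ∈ _
        rw [mul_one]
        exact Submodule.subset_span ⟨y, hy, rfl⟩
    | succ i ih =>
      obtain ⟨w, u, hb, hw, hv⟩ := ih
      obtain ⟨s, t, hst, hp, hβ, hb', ⟨u', hu'⟩, -⟩ := step i w u hb hv
      refine ⟨swapAt w s t, u', hb', ?_, hu'⟩
      rw [chainWeight_succ, hw, hβ, neg_rho_swapAt w hst hp]
  refine ⟨fun i => ?_, fun i => ?_⟩
  · obtain ⟨w, u, hb, hw, hv⟩ := main i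
    refine ⟨fun h0 => hv.eval_ne_zero ?_, fun y hy => ?_⟩
    · obtain ⟨a, ha, hau⟩ := hv.exists_rep
      rw [← hau, envLift_apply_eq_zero hu₀ (ha.symm.trans h0), map_zero]
    · rw [hb] at hy
      rw [hw, algebraMap_smul]
      exact hv.hasBorelWeight y hy
  · obtain ⟨w, u, hb, -, hv⟩ := main i.castSucc
    obtain ⟨s, t, -, -, -, -, -, hnot⟩ := step i w u hb hv
    refine SetLike.lt_iff_le_and_exists.2 ⟨?_, v i.castSucc, Submodule.mem_span_singleton_self _,
      hnot⟩
    rw [Submodule.span_singleton_le_iff_mem, hc.v_succ i]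
    exact Submodule.smul_mem _ _ (Submodule.mem_span_singleton_self _)

theorem single_mem_sl {i j : Idx n m} (hij : i ≠ j) :
    (Matrix.single i j 1 : Mat k n m) ∈ (sl k n m).toSubmodule := by
  change str (Matrix.single i j 1) = 0
  refine Finset.sum_eq_zero fun a _ => ?_
  rw [Matrix.single_apply_of_ne, mul_zero]
  rintro ⟨rfl, rfl⟩
  exact hij rfl

end SuperGL

end

theorem theorem4 (k : Type*) [Field k] [IsAlgClosed k] [CharZero k] (n m : ℕ)
    (hn : 0 < n) (hm : 0 < m) :
    SuperGL.ReflectionComplete (SuperGL.gl k n m) (-SuperGL.rho k (SuperGL.dist n m)) ∧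
    SuperGL.ReflectionComplete (SuperGL.sl k n m) (-SuperGL.rho k (SuperGL.dist n m)) := by
  exact ⟨SuperGL.reflectionComplete_neg_rho fun _ _ _ => Submodule.mem_top,
    SuperGL.reflectionComplete_neg_rho fun _ _ hij => SuperGL.single_mem_sl hij⟩
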